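/- Let $(X,\Phi,Y,\Phi^\vee)$ be a reduced root datum ($X$, $Y$ free of finite rank, $\Phi$ finite), $\Delta\subseteq\Phi^+$ a set of simple roots with its positive system, $W$ the Weyl group with reflections $s_\alpha$, and $\sigma$ an automorphism of the root datum with $\sigma(\Delta)=\Delta$; automorphisms act on $X$ and on $Y$ so that $\langle\sigma x,\sigma y\rangle=\langle x,y\rangle$. Let $\alpha_1,\dots,\alpha_r\in\Delta$ be representatives of the $\sigma$-orbits on $\Delta$ (each orbit represented exactly once), so that $c=s_{\alpha_1}\cdots s_{\alpha_r}$ is a $\sigma$-Coxeter element. Let $\mu\in Y$ and let $e\in\mathbb{Q}\Phi^\vee$ be the point with $\langle\alpha,\ \mu+c\sigma(e)-e\rangle=0$ for all $\alpha\in\Phi$. Put $\Phi_e=\{\alpha\in\Phi:\langle\alpha,e\rangle\in\mathbb{Z}\}$, let $\Delta_e$ be the set of simple roots of $\Phi_e^+=\Phi_e\cap\Phi^+$, and let $W_e$ be the Weyl group of $\Phi_e$. Let $\Phi'$ be the union of those $\sigma$-orbits of irreducible components of $\Phi$ that meet $\Phi_e$ (so $\Phi'=\Phi$ if $\Phi$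 is irreducible and $\Phi_e\neq\emptyset$). For a subset $I=\{i_1<\dots<i_m\}$ of $\{1,\dots,r\}$ with complement $\{j_1<\dots<j_{r-m}\}$ put $$\sigma_{I,c}=s_{\alpha_{i_1}}\cdots s_{\alpha_{i_m}}\sigma,\qquad \beta_{j}=\Big(\prod_{i\in I,\ i<j}s_{\alpha_i}\Big)(\alpha_{j})\quad(j\notin I),$$ $$c_I=s_{\beta_{j_1}}\cdots s_{\beta_{j_{r-m}}},\qquad \Delta_{I,c}=\{\beta_{j}: j\notin I\},$$ the product in $\beta_j$ being taken in increasing order of $i$. Theorem. There exists $I\subseteq\{1,\dots,r\}$ such that (1) $\sigma_{I,c}(\Delta_e)=\Delta_e$; (2) $\Delta_{I,c}\subseteq\Delta_e$, and $\Delta_{I,c}$ contains exactly one element of each $\sigma_{I,c}$-orbit on $\Delta_e$; (3) for every $n\in\mathbb{Z}$, $\sigma_{I,c}^n$ fixes every root of $\Phi'$ if and only if $\sigma_{I,c}^n$ fixes every root of $\Delta_e$ (thus, when $\Phi'=\Phi$, $\sigma_{I,c}^n=1$ as an automorphism of $\Phi$ if and only if $\sigma_{I,c}^n$ fixes every root of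 $\Delta_e$); and $c_I$ is a $\sigma_{I,c}$-Coxeter element of $W_e$: it lies in $W_e$ and has a reduced expression in the reflections $s_\beta$, $\beta\in\Delta_e$, that contains precisely one element from each $\sigma_{I,c}$-orbit. -/

import Mathlib

open scoped TensorProduct

noncomputable section

namespace TwistedCoxeter

variable {ι X Y : Type*} [AddCommGroup X] [AddCommGroup Y]

/-! ### Automorphisms of a root datum acting on roots and on (rational) cocharacters -/

/-- The permutation of the roots (as indices) induced by an automorphism of the root datum. -/
def rootPerm (P : RootDatum ι X Y) (g : P.Aut) : Equiv.Perm ι :=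
  RootPairing.Equiv.indexHom P g

/-- The left action of an automorphism `g` on cocharacters. It is the inverse of the
contravariant map attached to `g`, so that `⟨g x, g y⟩ = ⟨x, y⟩`. -/
def coAct (P : RootDatum ι X Y) (g : P.Aut) : Y →ₗ[ℤ] Y :=
  ((RootPairing.Equiv.coweightEquiv P P g).symm : Y ≃ₗ[ℤ] Y).toLinearMap

/-- The action of an automorphism on rational cocharacters `ℚ ⊗ Y`. -/
def coActRat (P : RootDatum ι X Y) (g : P.Aut) : ℚ ⊗[ℤ] Y →ₗ[ℚ] ℚ ⊗[ℤ] Y :=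
  (coAct P g).baseChange ℚ

/-- The pairing `⟨x, ·⟩` with a character `x`, extended to rational cocharacters. -/
def pairRat (P : RootDatum ι X Y) (x : X) : ℚ ⊗[ℤ] Y →ₗ[ℚ] ℚ :=
  (TensorProduct.AlgebraTensorModule.rid ℤ ℚ ℚ).toLinearMap ∘ₗ
    (P.toLinearMap x).baseChange ℚ

/-- The rational span of the coroots. -/
def corootSpanRat (P : RootDatum ι X Y) : Submodule ℚ (ℚ ⊗[ℤ] Y) :=
  Submodule.span ℚ (Set.range fun i => (1 : ℚ) ⊗ₜ[ℤ] P.coroot i)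

/-- The rational cocharacters of the center: those that are orthogonal to all roots. -/
def centralRat (P : RootDatum ι X Y) : Submodule ℚ (ℚ ⊗[ℤ] Y) :=
  ⨅ i, LinearMap.ker (pairRat P (P.root i))

/-- `e` is the point of the rational coroot space that is fixed, modulo central cocharacters,
by the affine map `x ↦ μ + g x`. -/
def IsFixedPoint (P : RootDatum ι X Y) (g : P.Aut) (μ : Y) (e : ℚ ⊗[ℤ] Y) : Prop :=
  e ∈ corootSpanRat P ∧ (1 : ℚ) ⊗ₜ[ℤ] μ + coActRat P g e - e ∈ centralRat P

/-! ### The root system of a point -/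

/-- The roots `α` with `⟨α, e⟩ ∈ ℤ`. -/
def rootsAt (P : RootDatum ι X Y) (e : ℚ ⊗[ℤ] Y) : Set ι :=
  {i | ∃ n : ℤ, pairRat P (P.root i) e = n}

/-- The positive roots of `rootsAt P e`. -/
def posRootsAt {P : RootDatum ι X Y} (b : P.Base) (e : ℚ ⊗[ℤ] Y) : Set ι :=
  {i | i ∈ rootsAt P e ∧ b.IsPos i}

/-- The simple roots of `rootsAt P e`: the members of `posRootsAt b e` that are not the sum of
two members of `posRootsAt b e`. -/
def simpleRootsAt {P : RootDatum ι X Y} (b : P.Base) (e : ℚ ⊗[ℤ] Y) : Set ι :=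
  {i | i ∈ posRootsAt b e ∧
    ¬ ∃ j ∈ posRootsAt b e, ∃ k ∈ posRootsAt b e, P.root i = P.root j + P.root k}

/-- The Weyl group of `rootsAt P e`. -/
def weylAt (P : RootDatum ι X Y) (e : ℚ ⊗[ℤ] Y) : Subgroup P.Aut :=
  Subgroup.closure (RootPairing.Equiv.reflection P '' rootsAt P e)

/-! ### Words in reflections and twisted Coxeter elements -/

/-- The product of the reflections in the roots of a word. -/
def wordProd (P : RootDatum ι X Y) (l : List ι) : P.Aut :=
  (l.map (RootPairing.Equiv.reflection P)).prod

/-- The roots `i` and `j` lie in the same orbit of (the cyclic group generated by) `τ`. -/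
def SameOrbit (P : RootDatum ι X Y) (τ : P.Aut) (i j : ι) : Prop :=
  ∃ k : ℤ, rootPerm P (τ ^ k) i = j

/-- `l` is a reduced expression of `w` in the reflections of the roots in `D`. -/
def IsReducedWord (P : RootDatum ι X Y) (D : Set ι) (l : List ι) (w : P.Aut) : Prop :=
  (∀ i ∈ l, i ∈ D) ∧ wordProd P l = w ∧
    ∀ l' : List ι, (∀ i ∈ l', i ∈ D) → wordProd P l' = w → l.length ≤ l'.length

/-- For an automorphism `τ` that stabilizes the set `D` of simple roots: `w` is a `τ`-Coxeter
element of the group generated by the reflections in `D`, that is, it has a reduced expression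
with precisely one entry from each `τ`-orbit on `D`. -/
def IsCoxeterElement (P : RootDatum ι X Y) (D : Set ι) (τ w : P.Aut) : Prop :=
  ∃ l : List ι, IsReducedWord P D l w ∧
    ∀ i ∈ D, ∃! k : Fin l.length, SameOrbit P τ i (l.get k)

/-! ### Subsequences of an expression `c = s_{α 1} ⋯ s_{α r}` -/

variable {r : ℕ}

/-- The product of the `s_{α k}`, `k ∈ I`, in increasing order of `k`. -/
def subProd (P : RootDatum ι X Y) (α : Fin r → ι) (I : Finset (Fin r)) : P.Aut :=
  wordProd P ((I.sort (· ≤ ·)).map α)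

/-- The element `c = s_{α 1} ⋯ s_{α r}`. -/
def coxeterProd (P : RootDatum ι X Y) (α : Fin r → ι) : P.Aut :=
  wordProd P (List.ofFn α)

/-- The automorphism `σ_{I,c}`, the product of the `s_{α k}`, `k ∈ I`, followed by `σ` on the
right. -/
def sigmaSub (P : RootDatum ι X Y) (σ : P.Aut) (α : Fin r → ι) (I : Finset (Fin r)) : P.Aut :=
  subProd P α I * σ

/-- The root `β_j`, the image of `α j` under the product of the `s_{α i}`, `i ∈ I`, `i < j`. -/
def betaSub (P : RootDatum ι X Y) (α : Fin r → ι) (I : Finset (Fin r)) (j : Fin r) : ι :=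
  rootPerm P (subProd P α {i ∈ I | i < j}) (α j)

/-- The element `c_I`, the product of the `s_{β_j}`, `j ∉ I`, in increasing order of `j`. -/
def coxeterSub (P : RootDatum ι X Y) (α : Fin r → ι) (I : Finset (Fin r)) : P.Aut :=
  wordProd P ((Iᶜ.sort (· ≤ ·)).map (betaSub P α I))

/-- The set `Δ_{I,c}` of the roots `β_j`, `j ∉ I`. -/
def deltaSub (P : RootDatum ι X Y) (α : Fin r → ι) (I : Finset (Fin r)) : Set ι :=
  {i | ∃ j, j ∉ I ∧ i = betaSub P α I j}

/-! ### Irreducible components -/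

/-- The roots `i` and `j` lie in the same irreducible component: they are joined by a chain of
successively non-orthogonal roots. -/
def SameComponent (P : RootDatum ι X Y) (i j : ι) : Prop :=
  Relation.EqvGen (fun a b => P.pairing a b ≠ 0) i j

/-- The union of the `σ`-translates of those irreducible components that contain a root `α` with
`⟨α, e⟩ ∈ ℤ`. -/
def componentsAt (P : RootDatum ι X Y) (σ : P.Aut) (e : ℚ ⊗[ℤ] Y) : Set ι :=
  {i | ∃ j ∈ rootsAt P e, ∃ k : ℤ, SameComponent P i (rootPerm P (σ ^ k) j)}

end TwistedCoxeter

end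

noncomputable section

namespace TwistedCoxeter

open scoped TensorProduct

variable {ι X Y : Type*} [AddCommGroup X] [AddCommGroup Y]

open RootPairing (Equiv.reflection)

/-! ### The actions of automorphisms on roots and characters -/

section Action

variable (P : RootDatum ι X Y)

/-! Put g = cσ. The set I is chosen greedily: reading c from the left, j enters I exactly when β_j,
formed with the earlier members of I, is not in Φ_e. Telescoping gives c_I σ_{I,c} = g
(`coxeterSub_mul_sigmaSub`). Since e is fixed by x ↦ μ + g x modulo the centre, g preserves Φ_e; so
do the reflections in the β_j, j ∉ I, hence so does σ_{I,c}. A simple reflection makes only one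
positive root negative, and the greedy rule keeps Φ_e away from it, so inverse partial products over
I keep Φ_e^+ positive (`isPos_subProd_inv`). This yields (1) and the simplicity of the β_j, j ∉ I,
in Φ_e.

For (2), the sum of the coefficients over the σ-orbit of α_j, j ∉ I, is invariant under σ_{I,c} and
separates β_j from the other β_k. An orbit on Δ_e without any β_j would give a functional that is
g-invariant on Φ_e and equals 1 at some root; summing that root over the powers of g gives a nonzero
g-fixed vector of the root lattice, but a twisted Coxeter element has none
(`eq_zero_of_coxeterProd_smul_eq`). The word for c_I is reduced because its letters are distinct and
Δ_e is linearly independent.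

For (3), a power τ of σ_{I,c} that fixes the β_j commutes with g. The sum of the coefficients over
the orbits of the α_k, k ∉ I, is dominant and τ-invariant, but may vanish at simple roots of Φ'.
Conjugating g to other twisted Coxeter elements and adding translates of the functional shrinks its
zero set until that set is σ-stable and orthogonal to the other simple roots
(`IsConfiguration.exists_minimal`); it then misses Φ'. The conjugate w σ^n of τ preserves a
functional that is now positive on the positive roots of Φ', so w is trivial there, and commuting
with a twisted Coxeter element forces σ^n to be trivial there too
(`IsTransversal.rootPerm_eq_self_of_commute`). -/

lemma root_rootPerm (g : P.Aut) (i : ι) : P.root (rootPerm P g i) = g • P.root i :=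
  RootPairing.Equiv.root_indexEquiv_eq_smul P i g

@[simp] lemma rootPerm_one (i : ι) : rootPerm P 1 i = i := rfl

@[simp] lemma rootPerm_mul (g h : P.Aut) (i : ι) :
    rootPerm P (g * h) i = rootPerm P g (rootPerm P h i) := rfl

lemma rootPerm_reflection (i j : ι) :
    rootPerm P (Equiv.reflection P i) j = P.reflectionPerm i j := rfl

@[simp] lemma rootPerm_inv_self (g : P.Aut) (i : ι) :
    rootPerm P g⁻¹ (rootPerm P g i) = i := by
  rw [← rootPerm_mul, inv_mul_cancel, rootPerm_one]

@[simp] lemma rootPerm_self_inv (g : P.Aut) (i : ι) :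
    rootPerm P g (rootPerm P g⁻¹ i) = i := by
  rw [← rootPerm_mul, mul_inv_cancel, rootPerm_one]

lemma reflection_smul (i : ι) (x : X) :
    Equiv.reflection P i • x = x - P.coroot' i x • P.root i := by
  rw [RootPairing.Equiv.reflection_smul, RootPairing.reflection_apply]

lemma reflection_smul_root (i j : ι) :
    Equiv.reflection P i • P.root j = P.root j - P.pairing j i • P.root i := by
  rw [reflection_smul]; rfl

lemma reflection_smul_root_self (i : ι) :
    Equiv.reflection P i • P.root i = -P.root i := by
  rw [reflection_smul_root, RootPairing.pairing_same, two_smul]; abel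

lemma coroot'_smul (g : P.Aut) (i : ι) (x : X) :
    P.coroot' (rootPerm P g i) (g • x) = P.coroot' i x := by
  have h := LinearMap.congr_fun (LinearMap.congr_fun g.weight_coweight_transpose
    (P.coroot (rootPerm P g i))) x
  have h2 := congr_fun g.coroot_coweightMap (rootPerm P g i)
  have h3 : g.indexEquiv.symm (rootPerm P g i) = i := g.indexEquiv.symm_apply_apply i
  simp only [Function.comp_apply, h3] at h2
  simp only [LinearMap.coe_comp, LinearEquiv.coe_coe, Function.comp_apply] at h
  rw [h2] at h
  exact h

lemma pairing_rootPerm (g : P.Aut) (i j : ι) :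
    P.pairing (rootPerm P g i) (rootPerm P g j) = P.pairing i j := by
  have := coroot'_smul P g j (P.root i)
  rw [← root_rootPerm] at this
  exact this

lemma aut_ext {g h : P.Aut} (H : ∀ x : X, g • x = h • x) : g = h :=
  RootPairing.Equiv.weightHom_injective P (LinearEquiv.ext H)

lemma conj_reflection (g : P.Aut) (i : ι) :
    g * Equiv.reflection P i * g⁻¹ = Equiv.reflection P (rootPerm P g i) := by
  apply aut_ext
  intro x
  have h := coroot'_smul P g i (g⁻¹ • x)
  rw [smul_inv_smul] at h
  rw [mul_smul, mul_smul, reflection_smul, reflection_smul, smul_sub, smul_inv_smul, h,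
    root_rootPerm, smul_comm]

lemma reflection_mul_self (i : ι) :
    Equiv.reflection P i * Equiv.reflection P i = 1 := by
  conv_lhs => enter [1]; rw [← RootPairing.Equiv.reflection_inv]
  exact inv_mul_cancel _

lemma pairingIn_int [Finite ι] (i j : ι) : P.pairingIn ℤ i j = P.pairing i j := by
  have := P.algebraMap_pairingIn ℤ i j
  simpa using this

lemma isTorsionFree_character {ι X Y : Type*} [AddCommGroup X] [AddCommGroup Y]
    (P : RootDatum ι X Y) : Module.IsTorsionFree ℤ X := by
  have : Module.IsReflexive ℤ X := .of_isPerfPair P.toLinearMap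
  infer_instance

lemma isTorsionFree_cocharacter {ι X Y : Type*} [AddCommGroup X] [AddCommGroup Y]
    (P : RootDatum ι X Y) : Module.IsTorsionFree ℤ Y :=
  isTorsionFree_character P.flip

lemma pairing_eq_zero_comm [Finite ι] {i j : ι} : P.pairing i j = 0 ↔ P.pairing j i = 0 :=
  have := isTorsionFree_character P
  have := isTorsionFree_cocharacter P
  P.pairing_eq_zero_iff

lemma rootPerm_injective (g : P.Aut) : Function.Injective (rootPerm P g) :=
  (rootPerm P g).injective

end Action

/-! ### Words in reflections -/

section Word

variable (P : RootDatum ι X Y)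

@[simp] lemma wordProd_nil : wordProd P [] = 1 := rfl

@[simp] lemma wordProd_cons (i : ι) (l : List ι) :
    wordProd P (i :: l) = Equiv.reflection P i * wordProd P l := by
  simp [wordProd]

@[simp] lemma wordProd_append (l₁ l₂ : List ι) :
    wordProd P (l₁ ++ l₂) = wordProd P l₁ * wordProd P l₂ := by
  simp [wordProd]

lemma wordProd_reverse (l : List ι) : wordProd P l.reverse = (wordProd P l)⁻¹ := by
  induction l with
  | nil => simp
  | cons i l ih =>
    rw [List.reverse_cons, wordProd_append, ih, wordProd_cons, wordProd_cons, wordProd_nil,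
      mul_one, mul_inv_rev, RootPairing.Equiv.reflection_inv]

lemma conj_wordProd (g : P.Aut) (l : List ι) :
    g * wordProd P l * g⁻¹ = wordProd P (l.map (rootPerm P g)) := by
  induction l with
  | nil => simp
  | cons i l ih =>
    rw [List.map_cons, wordProd_cons, wordProd_cons, ← ih, ← conj_reflection]
    group

lemma map_reflection_smul {f : X →+ ℚ} {i : ι} (h : f (P.root i) = 0) (x : X) :
    f (Equiv.reflection P i • x) = f x := by
  rw [reflection_smul, map_sub, map_zsmul, h, smul_zero, sub_zero]

lemma map_wordProd_smul {f : X →+ ℚ} {l : List ι} (h : ∀ i ∈ l, f (P.root i) = 0) (x : X) :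
    f (wordProd P l • x) = f x := by
  induction l with
  | nil => simp
  | cons i l ih =>
    rw [wordProd_cons, mul_smul, map_reflection_smul P (h i (by simp)),
      ih fun j hj => h j (by simp [hj])]

lemma map_wordProd_inv_smul {f : X →+ ℚ} {l : List ι} (h : ∀ i ∈ l, f (P.root i) = 0) (x : X) :
    f ((wordProd P l)⁻¹ • x) = f x := by
  rw [← wordProd_reverse]
  exact map_wordProd_smul P (by simpa using h) x

/-- A word that contains `k` exactly once and a word that does not contain `k` act differently,
when some functional vanishes at all the letters except `k`. -/
lemma exists_wordProd_ne {f : X →+ ℚ} {k : ι} (hk : f (P.root k) ≠ 0) {l₁ l₂ l' : List ι}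
    (h₁ : ∀ i ∈ l₁, f (P.root i) = 0) (h₂ : ∀ i ∈ l₂, f (P.root i) = 0)
    (h' : ∀ i ∈ l', f (P.root i) = 0) :
    rootPerm P (wordProd P (l₁ ++ k :: l₂)) (rootPerm P (wordProd P l₂)⁻¹ k) ≠
      rootPerm P (wordProd P l') (rootPerm P (wordProd P l₂)⁻¹ k) := by
  intro h
  -- All letters except k preserve f, so the two sides have f-values -f(k) and f(k).
  have h := congrArg (fun i => f (P.root i)) h
  simp only [root_rootPerm, map_wordProd_smul P h', map_wordProd_inv_smul P h₂] at h
  rw [wordProd_append, wordProd_cons, mul_smul, mul_smul, smul_inv_smul, map_wordProd_smul P h₁,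
    reflection_smul_root_self, map_neg] at h
  apply hk
  linarith

end Word

/-! ### Functionals on the character lattice -/

section Functional

variable {P : RootDatum ι X Y}

/-- ℚ is divisible, hence injective, so a functional on the span of the independent roots extends to
X. -/
lemma exists_functional {S : Set ι} (hS : LinearIndepOn ℤ P.root S) (a : ι → ℚ) :
    ∃ f : X →+ ℚ, ∀ i ∈ S, f (P.root i) = a i := by
  let v : S → X := fun i => P.root i
  have hv : LinearIndependent ℤ v := hS
  let B := Module.Basis.span hv
  let f₀ : Submodule.span ℤ (Set.range v) →ₗ[ℤ] ℚ := B.constr ℤ fun i => a i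
  obtain ⟨f, hf⟩ := (Module.Baer.of_divisible ℚ).extension_property_addMonoidHom
    (Submodule.span ℤ (Set.range v)).subtype.toAddMonoidHom Subtype.val_injective
    f₀.toAddMonoidHom
  refine ⟨f, fun i hi => ?_⟩
  have h := DFunLike.congr_fun hf (B ⟨i, hi⟩)
  have hB : ((B ⟨i, hi⟩ : Submodule.span ℤ (Set.range v)) : X) = P.root i := by
    simp [B, Module.Basis.span_apply, v]
  simp only [AddMonoidHom.comp_apply, LinearMap.toAddMonoidHom_coe, Submodule.subtype_apply, hB]
    at h
  rw [h]
  simp [f₀]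

/-- The functional with prescribed values at the simple roots. -/
lemma exists_functional_base (b : P.Base) (a : ι → ℚ) :
    ∃ f : X →+ ℚ, ∀ i ∈ b.support, f (P.root i) = a i :=
  exists_functional b.linearIndepOn_root a

variable (b : P.Base)

lemma eq_on_root_of_base {f f' : X →+ ℚ} (h : ∀ i ∈ b.support, f (P.root i) = f' (P.root i))
    (i : ι) : f (P.root i) = f' (P.root i) := by
  have h1 := b.root_mem_span_int i
  have : P.root i ∈ AddSubgroup.closure (P.root '' b.support) := by
    rwa [← Submodule.span_int_eq_addSubgroupClosure]
  have hle : AddSubgroup.closure (P.root '' b.support) ≤ f.eqLocus f' := by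
    rw [AddSubgroup.closure_le]
    rintro _ ⟨j, hj, rfl⟩
    exact h j hj
  exact hle this

end Functional

/-! ### Positive roots -/

section Positive

variable {P : RootDatum ι X Y} (b : P.Base)

lemma root_reflectionPerm_self_eq_neg (i : ι) : P.root (P.reflectionPerm i i) = -P.root i := by
  rw [← rootPerm_reflection, root_rootPerm, reflection_smul_root_self]

lemma isPos_or_isPos_neg (i : ι) : b.IsPos i ∨ b.IsPos (P.reflectionPerm i i) :=
  RootPairing.Base.IsPos.or_neg b i

lemma exists_mul_ge {S : Finset ι} (a c : ι → ℚ) :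
    ∃ M : ℚ, 0 < M ∧ ∀ i ∈ S, 0 < c i → a i < M * c i := by
  classical
  refine ⟨∑ i ∈ S, |a i / c i| + 1, by positivity, fun i hi hc => ?_⟩
  rw [← div_lt_iff₀ hc]
  have := Finset.single_le_sum (f := fun i => |a i / c i|) (fun i _ => abs_nonneg _) hi
  have := le_abs_self (a i / c i)
  linarith

variable [Finite ι]

variable {b} in
lemma map_nonneg_of_isPos {f : X →+ ℚ} (hf : ∀ i ∈ b.support, 0 ≤ f (P.root i)) {i : ι}
    (hi : b.IsPos i) : 0 ≤ f (P.root i) := by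
  refine hi.induction_on_add (p := fun i => 0 ≤ f (P.root i)) hf fun i j k hk hi hj => ?_
  rw [hk, map_add]
  exact add_nonneg hi (hf j hj)

variable {b} in
lemma isPos_of_map_pos {f : X →+ ℚ} (hf : ∀ i ∈ b.support, 0 ≤ f (P.root i)) {i : ι}
    (hi : 0 < f (P.root i)) : b.IsPos i := by
  refine (isPos_or_isPos_neg b i).resolve_right fun h => ?_
  have := map_nonneg_of_isPos hf h
  rw [root_reflectionPerm_self_eq_neg, map_neg] at this
  linarith

variable {b} in
-- φ is the coordinate at k, and f - f(k) φ is still nonnegative at the simple roots.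
lemma map_mul_le_of_isPos {f φ : X →+ ℚ} (hf : ∀ i ∈ b.support, 0 ≤ f (P.root i)) {i k : ι}
    (hk : φ (P.root k) = 1) (hφ : ∀ j ∈ b.support, j ≠ k → φ (P.root j) = 0)
    (hi : b.IsPos i) : φ (P.root i) * f (P.root k) ≤ f (P.root i) := by
  have := map_nonneg_of_isPos (b := b) (f := f - (AddMonoidHom.mulRight (f (P.root k))).comp φ)
    (fun j hj => ?_) hi
  · simpa using this
  · by_cases hjk : j = k
    · simp [hjk, hk]
    · simpa [hφ j hj hjk] using hf j hj

/-- The pairing with a coroot, as a rational functional. -/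
def corootFunctional (P : RootDatum ι X Y) (i : ι) : X →+ ℚ :=
  (Int.castAddHom ℚ).comp (P.coroot' i).toAddMonoidHom

omit [Finite ι] in
lemma corootFunctional_root (i j : ι) : corootFunctional P i (P.root j) = P.pairing j i := rfl

variable {b} in
-- For large M the functional M f - ⟨·, α_i^∨⟩ is nonnegative at the simple roots, and its value at
-- α_i is M f(α_i) - 2.
lemma map_pos_of_isPos {f : X →+ ℚ} (hf : ∀ i ∈ b.support, 0 ≤ f (P.root i)) {i : ι}
    (h : ∀ k ∈ b.support, P.pairing k i ≠ 0 → 0 < f (P.root k)) (hi : b.IsPos i) :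
    0 < f (P.root i) := by
  obtain ⟨M, hM0, hM⟩ := exists_mul_ge (S := b.support) (fun k => (P.pairing k i : ℚ))
    (fun k => f (P.root k))
  have := map_nonneg_of_isPos (b := b)
    (f := (AddMonoidHom.mulLeft M).comp f - corootFunctional P i) (fun k hk => ?_) hi
  · simp only [AddMonoidHom.sub_apply, AddMonoidHom.comp_apply, AddMonoidHom.coe_mulLeft,
      corootFunctional_root, RootPairing.pairing_same] at this
    push_cast at this
    by_contra! h0
    nlinarith
  · simp only [AddMonoidHom.sub_apply, AddMonoidHom.comp_apply, AddMonoidHom.coe_mulLeft,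
      corootFunctional_root]
    by_cases hp : P.pairing k i = 0
    · simpa [hp] using mul_nonneg hM0.le (hf k hk)
    · linarith [hM k hk (h k hk hp)]

variable {σ : P.Aut} (hσ : rootPerm P σ '' b.support = b.support)

section

include hσ

omit [Finite ι] in
variable {b} in
lemma rootPerm_mem_support_iff {i : ι} : rootPerm P σ i ∈ b.support ↔ i ∈ b.support := by
  have h := (rootPerm_injective P σ).mem_set_image (s := b.support) (a := i)
  rwa [hσ] at h

omit [Finite ι] in
variable {b} in
lemma rootPerm_zpow_image (m : ℤ) : rootPerm P (σ ^ m) '' b.support = b.support := by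
  have h1 : ∀ i ∈ b.support, rootPerm P σ⁻¹ i ∈ b.support := fun i hi => by
    rw [← rootPerm_mem_support_iff hσ, rootPerm_self_inv]; exact hi
  have hsub : ∀ m : ℤ, ∀ i ∈ b.support, rootPerm P (σ ^ m) i ∈ b.support := by
    intro m
    induction m using Int.induction_on with
    | zero => simp
    | succ n ih =>
      intro i hi
      rw [zpow_add_one, rootPerm_mul]
      exact ih _ ((rootPerm_mem_support_iff hσ).2 hi)
    | pred n ih =>
      intro i hi
      rw [zpow_sub_one, rootPerm_mul]
      exact ih _ (h1 i hi)
  apply Set.Subset.antisymm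
  · rintro _ ⟨i, hi, rfl⟩
    exact hsub m i hi
  · intro i hi
    refine ⟨rootPerm P (σ ^ (-m)) i, hsub _ i hi, ?_⟩
    rw [← rootPerm_mul, ← zpow_add, add_neg_cancel, zpow_zero, rootPerm_one]

variable {b} in
lemma isPos_rootPerm_iff {i : ι} : b.IsPos (rootPerm P σ i) ↔ b.IsPos i := by
  have key : ∀ τ : P.Aut, rootPerm P τ '' b.support = b.support → ∀ i, b.IsPos i →
      b.IsPos (rootPerm P τ i) := by
    intro τ hτ i hi
    refine hi.induction_on_add (p := fun i => b.IsPos (rootPerm P τ i))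
      (fun i hi => RootPairing.Base.isPos_of_mem_support ((rootPerm_mem_support_iff hτ).2 hi))
      fun i j k hk hi hj => hi.add
        (RootPairing.Base.isPos_of_mem_support ((rootPerm_mem_support_iff hτ).2 hj)) ?_
    rw [root_rootPerm, hk, smul_add, root_rootPerm, root_rootPerm]
  refine ⟨fun h => ?_, key σ hσ i⟩
  have h2 := key (σ ^ (-1 : ℤ)) (rootPerm_zpow_image hσ (-1)) _ h
  rwa [zpow_neg_one, rootPerm_inv_self] at h2

omit [Finite ι] in
/-- The sum of the coefficients over a stable set of simple roots is an invariant functional. -/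
lemma exists_invariant_functional (a : ι → ℚ) (ha : ∀ i, a (rootPerm P σ i) = a i) :
    ∃ f : X →+ ℚ, (∀ i ∈ b.support, f (P.root i) = a i) ∧
      ∀ i, f (σ • P.root i) = f (P.root i) := by
  obtain ⟨f, hf⟩ := exists_functional_base b a
  refine ⟨f, hf, fun i => ?_⟩
  refine eq_on_root_of_base b (f := f.comp (DistribSMul.toAddMonoidHom X σ)) (f' := f)
    (fun j hj => ?_) i
  change f (σ • P.root j) = _
  rw [← root_rootPerm, hf _ ((rootPerm_mem_support_iff hσ).2 hj), hf j hj, ha]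

end

/-! ### Orbits and components -/

section Orbit

omit [Finite ι]

variable {τ : P.Aut} {i j k : ι}

lemma SameOrbit.refl (τ : P.Aut) (i : ι) : SameOrbit P τ i i := ⟨0, by simp⟩

lemma SameOrbit.symm (h : SameOrbit P τ i j) : SameOrbit P τ j i := by
  obtain ⟨m, rfl⟩ := h
  exact ⟨-m, by rw [← rootPerm_mul, ← zpow_add, neg_add_cancel, zpow_zero, rootPerm_one]⟩

lemma SameOrbit.trans (h : SameOrbit P τ i j) (h' : SameOrbit P τ j k) : SameOrbit P τ i k := by
  obtain ⟨m, rfl⟩ := h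
  obtain ⟨n, rfl⟩ := h'
  exact ⟨n + m, by rw [zpow_add, rootPerm_mul]⟩

lemma sameOrbit_rootPerm (τ : P.Aut) (i : ι) : SameOrbit P τ i (rootPerm P τ i) := ⟨1, by simp⟩

lemma sameOrbit_rootPerm_zpow (τ : P.Aut) (m : ℤ) (i : ι) :
    SameOrbit P τ i (rootPerm P (τ ^ m) i) := ⟨m, rfl⟩

lemma sameOrbit_rootPerm_iff : SameOrbit P τ (rootPerm P τ i) j ↔ SameOrbit P τ i j :=
  ⟨(sameOrbit_rootPerm τ i).trans, (sameOrbit_rootPerm τ i).symm.trans⟩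

/-- A function that is invariant under `τ` is constant on orbits. -/
lemma SameOrbit.eq_of_invariant {A : Type*} {F : ι → A} (hF : ∀ i, F (rootPerm P τ i) = F i)
    (h : SameOrbit P τ i j) : F i = F j := by
  obtain ⟨m, rfl⟩ := h
  induction m using Int.induction_on with
  | zero => simp
  | succ n ih => rw [ih, add_comm, zpow_add, zpow_one, rootPerm_mul, hF]
  | pred n ih =>
    rw [ih, sub_eq_neg_add, zpow_add, zpow_neg_one, rootPerm_mul, ← hF (rootPerm P τ⁻¹ _),
      rootPerm_self_inv]

lemma SameComponent.rootPerm (g : P.Aut) (h : SameComponent P i j) :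
    SameComponent P (rootPerm P g i) (rootPerm P g j) := by
  induction h with
  | rel a b h => exact .rel _ _ (by rwa [pairing_rootPerm])
  | refl => exact .refl _
  | symm _ _ _ ih => exact ih.symm
  | trans _ _ _ _ _ ih ih' => exact ih.trans _ _ _ ih'

lemma sameComponent_reflection (i j : ι) :
    SameComponent P i (TwistedCoxeter.rootPerm P (Equiv.reflection P j) i) := by
  by_cases h : P.pairing i j = 0
  · have : TwistedCoxeter.rootPerm P (Equiv.reflection P j) i = i := by
      apply P.root.injective
      rw [root_rootPerm, reflection_smul_root, h, zero_smul, sub_zero]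
    rw [this]
    exact .refl _
  · refine .trans _ j _ (.rel _ _ h) (.symm _ _ (.rel _ _ ?_))
    rw [rootPerm_reflection, ← P.pairing_reflectionPerm, P.pairing_reflectionPerm_self_right]
    exact neg_ne_zero.2 h

lemma sameComponent_wordProd (l : List ι) (i : ι) :
    SameComponent P i (TwistedCoxeter.rootPerm P (wordProd P l) i) := by
  induction l with
  | nil => exact .refl _
  | cons j l ih =>
    rw [wordProd_cons, rootPerm_mul]
    exact ih.trans _ _ _ (sameComponent_reflection _ _)

end Orbit

end Positive

/-! ### Subsequences -/

section Subsequence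

variable {r : ℕ}

/-- The members of `I` that are smaller than `m`. -/
def below (I : Finset (Fin r)) (m : ℕ) : Finset (Fin r) := {i ∈ I | (i : ℕ) < m}

lemma mem_below {I : Finset (Fin r)} {m : ℕ} {i : Fin r} : i ∈ below I m ↔ i ∈ I ∧ (i : ℕ) < m := by
  simp [below]

lemma below_zero (I : Finset (Fin r)) : below I 0 = ∅ := by simp [below]

lemma below_of_le (I : Finset (Fin r)) {m : ℕ} (h : r ≤ m) : below I m = I := by
  ext i; simp only [mem_below, and_iff_left_iff_imp]; intro _; omega

lemma below_succ_of_mem {I : Finset (Fin r)} {j : Fin r} (h : j ∈ I) :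
    below I (j + 1) = insert j (below I j) := by
  ext i; simp only [mem_below, Finset.mem_insert, Fin.ext_iff]
  constructor
  · rintro ⟨h1, h2⟩; by_cases hij : (i : ℕ) = j
    · exact .inl hij
    · exact .inr ⟨h1, by omega⟩
  · rintro (h1 | ⟨h1, h2⟩)
    · rw [Fin.ext h1]; exact ⟨h, by omega⟩
    · exact ⟨h1, by omega⟩

lemma below_succ_of_notMem {I : Finset (Fin r)} {j : Fin r} (h : j ∉ I) :
    below I (j + 1) = below I j := by
  ext i; simp only [mem_below]
  refine and_congr_right fun hi => ?_
  have : (i : ℕ) ≠ j := fun h' => h (Fin.ext h' ▸ hi)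
  omega

lemma sort_insert_of_forall_lt {S : Finset (Fin r)} {j : Fin r} (h : ∀ i ∈ S, i < j) :
    (insert j S).sort (· ≤ ·) = S.sort (· ≤ ·) ++ [j] := by
  have hj : j ∉ S := fun hj => lt_irrefl _ (h j hj)
  refine List.Perm.eq_of_pairwise' (r := (· ≤ ·)) (Finset.pairwise_sort _ _) ?_ ?_
  · rw [List.pairwise_append]
    refine ⟨Finset.pairwise_sort _ _, by simp, ?_⟩
    intro a ha c hc
    rw [Finset.mem_sort] at ha
    rw [List.mem_singleton.1 hc]
    exact (h a ha).le
  · rw [← Multiset.coe_eq_coe, Finset.sort_eq, ← Multiset.coe_add, Finset.sort_eq,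
      Finset.insert_val_of_notMem hj, ← Multiset.singleton_add, add_comm]
    rfl

variable (P : RootDatum ι X Y)

lemma subProd_below_succ_of_mem (α : Fin r → ι) {I : Finset (Fin r)} {j : Fin r} (h : j ∈ I) :
    subProd P α (below I (j + 1)) = subProd P α (below I j) * Equiv.reflection P (α j) := by
  rw [below_succ_of_mem h, subProd, sort_insert_of_forall_lt (fun i hi => (mem_below.1 hi).2),
    List.map_append, wordProd_append]
  simp [subProd]

lemma betaSub_eq (α : Fin r → ι) (I : Finset (Fin r)) (j : Fin r) :
    betaSub P α I j = rootPerm P (subProd P α (below I j)) (α j) := rfl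

lemma coxeterSub_eq (α : Fin r → ι) (I : Finset (Fin r)) :
    coxeterSub P α I = subProd P (betaSub P α I) Iᶜ := rfl

lemma coxeterProd_eq (α : Fin r → ι) : coxeterProd P α = subProd P α Finset.univ := by
  rw [coxeterProd, subProd, Fin.sort_univ, List.ofFn_eq_map]

/-- The factorization `c_I σ_{I,c} = c σ`, up to the factor `σ`. -/
lemma coxeterSub_mul_subProd (α : Fin r → ι) (I : Finset (Fin r)) :
    coxeterSub P α I * subProd P α I = coxeterProd P α := by
  -- Truncate at the letters below m. With w the partial product over I, a new letter j ∉ I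
  -- contributes s_{β_j} = w s_{α_j} w⁻¹, which cancels against w.
  have key : ∀ m ≤ r, subProd P (betaSub P α I) (below Iᶜ m) * subProd P α (below I m) =
      subProd P α (below Finset.univ m) := by
    intro m
    induction m with
    | zero => intro _; simp [below_zero, subProd]
    | succ m ih =>
      intro hm
      have ih := ih (by omega)
      let j : Fin r := ⟨m, hm⟩
      change subProd P (betaSub P α I) (below Iᶜ (j + 1)) * subProd P α (below I (j + 1)) =
        subProd P α (below Finset.univ (j + 1))
      change subProd P (betaSub P α I) (below Iᶜ j) * subProd P α (below I j) =
        subProd P α (below Finset.univ j) at ih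
      rw [subProd_below_succ_of_mem P α (Finset.mem_univ j), ← ih]
      by_cases hj : j ∈ I
      · rw [subProd_below_succ_of_mem P α hj, below_succ_of_notMem (by simpa using hj), mul_assoc]
      · rw [below_succ_of_notMem hj, subProd_below_succ_of_mem P _ (by simpa using hj),
          betaSub_eq, ← conj_reflection]
        group
  have h := key r le_rfl
  rwa [below_of_le _ le_rfl, below_of_le _ le_rfl, below_of_le _ le_rfl, ← coxeterSub_eq,
    ← coxeterProd_eq] at h

/-- The subset of `Fin r` obtained by a greedy choice. -/
lemma exists_greedy (Q : Finset (Fin r) → Fin r → Prop) :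
    ∃ I : Finset (Fin r), ∀ j, j ∈ I ↔ Q (below I j) j := by
  classical
  have key : ∀ m ≤ r, ∃ I : Finset (Fin r), (∀ i ∈ I, (i : ℕ) < m) ∧
      ∀ j : Fin r, (j : ℕ) < m → (j ∈ I ↔ Q (below I j) j) := by
    intro m
    induction m with
    | zero => exact fun _ => ⟨∅, by simp, by simp⟩
    | succ m ih =>
      intro hm
      obtain ⟨I, hI, hQ⟩ := ih (by omega)
      let k : Fin r := ⟨m, hm⟩
      by_cases hk : Q I k
      · refine ⟨insert k I, fun i hi => ?_, fun j hj => ?_⟩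
        · rcases Finset.mem_insert.1 hi with rfl | hi
          · exact Nat.lt_succ_self m
          · exact (hI i hi).trans (Nat.lt_succ_self m)
        · have hb : below (insert k I) j = below I j := by
            ext i; simp only [mem_below, Finset.mem_insert]
            refine ⟨fun ⟨h1, h2⟩ => ⟨h1.resolve_left ?_, h2⟩, fun ⟨h1, h2⟩ => ⟨.inr h1, h2⟩⟩
            rintro rfl
            change m < _ at h2
            omega
          rw [hb]
          by_cases hjm : (j : ℕ) = m
          · obtain rfl : j = k := Fin.ext hjm
            have : below I k = I := by
              ext i; simp only [mem_below, and_iff_left_iff_imp]; exact hI i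
            simp [this, hk]
          · have : j ≠ k := fun h => hjm (congrArg Fin.val h)
            rw [Finset.mem_insert, ← hQ j (by omega)]
            simp [this]
      · refine ⟨I, fun i hi => (hI i hi).trans (Nat.lt_succ_self m), fun j hj => ?_⟩
        by_cases hjm : (j : ℕ) = m
        · obtain rfl : j = k := Fin.ext hjm
          have : below I k = I := by
            ext i; simp only [mem_below, and_iff_left_iff_imp]; exact hI i
          rw [this]
          exact iff_of_false (fun h => lt_irrefl _ (hI _ h)) hk
        · exact hQ j (by omega)
  obtain ⟨I, -, h⟩ := key r le_rfl
  exact ⟨I, fun j => h j j.2⟩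

end Subsequence

/-! ### The root system of a point -/

section RootsAt

variable {P : RootDatum ι X Y}

@[simp] lemma pairRat_tmul (x : X) (q : ℚ) (y : Y) :
    pairRat P x (q ⊗ₜ y) = q * P.toLinearMap x y := by
  simp [pairRat, mul_comm]

lemma pairRat_coActRat (g : P.Aut) (x : X) (e : ℚ ⊗[ℤ] Y) :
    pairRat P (g • x) (coActRat P g e) = pairRat P x e := by
  induction e with
  | zero => simp
  | add a b ha hb => rw [map_add, map_add, map_add, ha, hb]
  | tmul q y =>
    rw [coActRat, LinearMap.baseChange_tmul, pairRat_tmul, pairRat_tmul]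
    have h := LinearMap.congr_fun (LinearMap.congr_fun g.weight_coweight_transpose
      (coAct P g y)) x
    have h2 : g.coweightMap (coAct P g y) = y :=
      (RootPairing.Equiv.coweightEquiv P P g).apply_symm_apply y
    simp only [LinearMap.coe_comp, LinearEquiv.coe_coe, Function.comp_apply] at h
    rw [h2] at h
    congr 2
    

lemma pairRat_add (x x' : X) (e : ℚ ⊗[ℤ] Y) :
    pairRat P (x + x') e = pairRat P x e + pairRat P x' e := by
  induction e with
  | zero => simp
  | add a b ha hb => simp only [map_add, ha, hb]; ring
  | tmul q y => simp; ring

/-- The pairing with a rational cocharacter. -/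
def pairHom (P : RootDatum ι X Y) (e : ℚ ⊗[ℤ] Y) : X →+ ℚ where
  toFun x := pairRat P x e
  map_zero' := by simpa using pairRat_add (P := P) 0 0 e
  map_add' x x' := pairRat_add x x' e

lemma mem_rootsAt_iff {e : ℚ ⊗[ℤ] Y} {i : ι} :
    i ∈ rootsAt P e ↔ ∃ n : ℤ, pairHom P e (P.root i) = n := Iff.rfl

variable {e : ℚ ⊗[ℤ] Y}

lemma mem_rootsAt_of_eq_add {i j k : ι} {m : ℤ} (hi : i ∈ rootsAt P e) (hj : j ∈ rootsAt P e)
    (hk : P.root k = P.root i + m • P.root j) : k ∈ rootsAt P e := by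
  obtain ⟨a, ha⟩ := mem_rootsAt_iff.1 hi
  obtain ⟨c, hc⟩ := mem_rootsAt_iff.1 hj
  refine mem_rootsAt_iff.2 ⟨a + m * c, ?_⟩
  rw [hk, map_add, map_zsmul, ha, hc]
  simp

lemma reflection_mem_rootsAt {i j : ι} (hi : i ∈ rootsAt P e) (hj : j ∈ rootsAt P e) :
    rootPerm P (Equiv.reflection P j) i ∈ rootsAt P e := by
  refine mem_rootsAt_of_eq_add (m := -P.pairing i j) hi hj ?_
  rw [root_rootPerm, reflection_smul_root, neg_smul, sub_eq_add_neg]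

lemma wordProd_mem_rootsAt {l : List ι} (hl : ∀ j ∈ l, j ∈ rootsAt P e) {i : ι}
    (hi : i ∈ rootsAt P e) : rootPerm P (wordProd P l) i ∈ rootsAt P e := by
  induction l with
  | nil => simpa
  | cons j l ih =>
    rw [wordProd_cons, rootPerm_mul]
    exact reflection_mem_rootsAt (ih fun k hk => hl k (by simp [hk])) (hl j (by simp))

lemma wordProd_inv_mem_rootsAt {l : List ι} (hl : ∀ j ∈ l, j ∈ rootsAt P e) {i : ι}
    (hi : i ∈ rootsAt P e) : rootPerm P (wordProd P l)⁻¹ i ∈ rootsAt P e := by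
  rw [← wordProd_reverse]
  exact wordProd_mem_rootsAt (by simpa using hl) hi

/-- The roots at a fixed point are stable. -/
lemma IsFixedPoint.rootPerm_mem {g : P.Aut} {μ : Y} (he : IsFixedPoint P g μ e) {i : ι}
    (hi : i ∈ rootsAt P e) : rootPerm P g i ∈ rootsAt P e := by
  have h := he.2
  rw [centralRat, Submodule.mem_iInf] at h
  have h := h (rootPerm P g i)
  rw [LinearMap.mem_ker, map_sub, map_add, root_rootPerm, pairRat_coActRat, pairRat_tmul] at h
  obtain ⟨n, hn⟩ := hi
  -- Pairing the fixed-point equation with gα gives ⟨gα, e⟩ = ⟨gα, μ⟩ + ⟨α, e⟩.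
  refine ⟨P.toLinearMap (g • P.root i) μ + n, ?_⟩
  rw [root_rootPerm]
  push_cast
  rw [← hn]
  linarith

end RootsAt

/-! ### The greedy subsequence -/

section Greedy

/-- Finiteness enters here: an injective self-map of a finite set is onto. -/
lemma rootPerm_inv_mapsTo [Finite ι] {P : RootDatum ι X Y} {g : P.Aut} {S : Set ι}
    (h : ∀ i ∈ S, rootPerm P g i ∈ S) : ∀ i ∈ S, rootPerm P g⁻¹ i ∈ S := by
  have := Equiv.Perm.perm_symm_mapsTo_of_mapsTo (rootPerm P g) (s := S) h
  intro i hi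
  rw [rootPerm, map_inv]
  exact this hi

variable {P : RootDatum ι X Y} {b : P.Base} {e : ℚ ⊗[ℤ] Y}

lemma rootPerm_image_simpleRootsAt {τ : P.Aut}
    (h : ∀ i ∈ posRootsAt b e, rootPerm P τ i ∈ posRootsAt b e)
    (h' : ∀ i ∈ posRootsAt b e, rootPerm P τ⁻¹ i ∈ posRootsAt b e) :
    rootPerm P τ '' simpleRootsAt b e = simpleRootsAt b e := by
  have key : ∀ τ : P.Aut, (∀ i ∈ posRootsAt b e, rootPerm P τ i ∈ posRootsAt b e) →
      (∀ i ∈ posRootsAt b e, rootPerm P τ⁻¹ i ∈ posRootsAt b e) →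
      ∀ i ∈ simpleRootsAt b e, rootPerm P τ i ∈ simpleRootsAt b e := by
    rintro τ h h' i ⟨hi, hs⟩
    refine ⟨h i hi, ?_⟩
    rintro ⟨j, hj, k, hk, hjk⟩
    refine hs ⟨_, h' j hj, _, h' k hk, ?_⟩
    rw [root_rootPerm, root_rootPerm, ← smul_add, ← hjk, root_rootPerm, inv_smul_smul]
  apply Set.Subset.antisymm
  · rintro _ ⟨i, hi, rfl⟩
    exact key τ h h' i hi
  · intro i hi
    exact ⟨_, key τ⁻¹ h' (by simpa using h) i hi, rootPerm_self_inv ..⟩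

variable [Finite ι] {r : ℕ} {α : Fin r → ι}
  (hα : ∀ k, α k ∈ b.support) {I : Finset (Fin r)}
  (hI : ∀ j, j ∈ I ↔ betaSub P α I j ∉ rootsAt P e)

include hα hI

/-- s_{α_j} makes no positive root negative except α_j. If the image of i so far were α_j, then i =
β_j would lie in Φ_e, contrary to j ∈ I. -/
lemma isPos_subProd_inv [P.IsReduced] {m : ℕ} (hm : m ≤ r) {i : ι} (hi : i ∈ posRootsAt b e) :
    b.IsPos (rootPerm P (subProd P α (below I m))⁻¹ i) := by
  induction m with
  | zero => simpa [below_zero, subProd] using hi.2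
  | succ m ih =>
    have ih := ih (by omega)
    let j : Fin r := ⟨m, hm⟩
    change b.IsPos (rootPerm P (subProd P α (below I (j + 1)))⁻¹ i)
    change b.IsPos (rootPerm P (subProd P α (below I j))⁻¹ i) at ih
    by_cases hj : j ∈ I
    · rw [subProd_below_succ_of_mem P α hj, mul_inv_rev, RootPairing.Equiv.reflection_inv,
        rootPerm_mul]
      refine ih.reflectionPerm (hα j) fun h => (hI j).1 hj ?_
      rw [betaSub_eq, ← h, rootPerm_self_inv]
      exact hi.1
    · rwa [below_succ_of_notMem hj]

/-- The inverse partial product sends β_j to α_j and keeps Φ_e^+ positive. A negative β_j would make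
-α_j positive, and a decomposition of β_j would write α_j, of height one, as a sum of two positive
roots. -/
lemma betaSub_mem_simpleRootsAt [P.IsReduced] {j : Fin r} (hj : j ∉ I) :
    betaSub P α I j ∈ simpleRootsAt b e := by
  have hmem : betaSub P α I j ∈ rootsAt P e := by
    by_contra h
    exact hj ((hI j).2 h)
  have hinv : rootPerm P (subProd P α (below I j))⁻¹ (betaSub P α I j) = α j := by
    rw [betaSub_eq, rootPerm_inv_self]
  refine ⟨⟨hmem, (isPos_or_isPos_neg b _).resolve_right fun h => ?_⟩, ?_⟩
  · have := isPos_subProd_inv hα hI j.2.le ⟨reflection_mem_rootsAt hmem hmem, h⟩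
    have h2 : rootPerm P (subProd P α (below I j))⁻¹ (rootPerm P (Equiv.reflection P
        (betaSub P α I j)) (betaSub P α I j)) = P.reflectionPerm (α j) (α j) := by
      apply P.root.injective
      rw [root_rootPerm, root_rootPerm, reflection_smul_root_self, smul_neg, ← root_rootPerm, hinv,
        root_reflectionPerm_self_eq_neg]
    rw [h2] at this
    exact (RootPairing.Base.IsPos.neg_iff_not b (α j)).1 this
      (RootPairing.Base.isPos_of_mem_support (hα j))
  · rintro ⟨i, hi, k, hk, hik⟩
    have h1 := isPos_subProd_inv hα hI j.2.le hi
    have h2 := isPos_subProd_inv hα hI j.2.le hk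
    have h3 : P.root (α j) = P.root (rootPerm P (subProd P α (below I j))⁻¹ i) +
        P.root (rootPerm P (subProd P α (below I j))⁻¹ k) := by
      rw [root_rootPerm, root_rootPerm, ← smul_add, ← hik, ← root_rootPerm, hinv]
    have h4 := b.height_add h3
    rw [RootPairing.Base.height_one_of_mem_support (hα j)] at h4
    rw [RootPairing.Base.isPos_iff] at h1 h2
    omega

variable {σ : P.Aut} (hσ : rootPerm P σ '' b.support = b.support) {μ : Y}
  (he : IsFixedPoint P (coxeterProd P α * σ) μ e)

omit hα hI [Finite ι] in
lemma coxeterSub_mul_sigmaSub :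
    coxeterSub P α I * sigmaSub P σ α I = coxeterProd P α * σ := by
  rw [sigmaSub, ← mul_assoc, coxeterSub_mul_subProd]

omit hα [Finite ι] in
lemma betaSub_mem_rootsAt {k : ι} (hk : k ∈ (Iᶜ.sort (· ≤ ·)).map (betaSub P α I)) :
    k ∈ rootsAt P e := by
  obtain ⟨j, hj, rfl⟩ := List.mem_map.1 hk
  by_contra h
  exact (by simpa using hj : j ∉ I) ((hI j).2 h)

include he in
omit hα [Finite ι] in
-- σ_{I,c} = c_I⁻¹ g, where g preserves Φ_e by the fixed-point equation and c_I is a product of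
-- reflections in roots of Φ_e.
lemma sigmaSub_mem_rootsAt {i : ι} (hi : i ∈ rootsAt P e) :
    rootPerm P (sigmaSub P σ α I) i ∈ rootsAt P e := by
  have h : sigmaSub P σ α I = (coxeterSub P α I)⁻¹ * (coxeterProd P α * σ) := by
    rw [← coxeterSub_mul_sigmaSub (I := I), inv_mul_cancel_left]
  rw [h, rootPerm_mul]
  exact wordProd_inv_mem_rootsAt (fun k hk => betaSub_mem_rootsAt hI hk) (he.rootPerm_mem hi)

include hσ he

lemma sigmaSub_inv_mem_posRootsAt [P.IsReduced] {i : ι} (hi : i ∈ posRootsAt b e) :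
    rootPerm P (sigmaSub P σ α I)⁻¹ i ∈ posRootsAt b e := by
  refine ⟨rootPerm_inv_mapsTo (fun i hi => sigmaSub_mem_rootsAt hI he hi) i hi.1, ?_⟩
  have := isPos_subProd_inv hα hI le_rfl hi
  rw [below_of_le _ le_rfl] at this
  rw [sigmaSub, mul_inv_rev, rootPerm_mul, ← isPos_rootPerm_iff hσ, rootPerm_self_inv]
  exact this

/-- The automorphism `σ_{I,c}` stabilizes the simple roots at `e`. -/
lemma sigmaSub_image_simpleRootsAt [P.IsReduced] :
    rootPerm P (sigmaSub P σ α I) '' simpleRootsAt b e = simpleRootsAt b e := by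
  refine rootPerm_image_simpleRootsAt (fun i hi => ?_)
    fun i hi => sigmaSub_inv_mem_posRootsAt hα hI hσ he hi
  have := rootPerm_inv_mapsTo (S := posRootsAt b e) (g := (sigmaSub P σ α I)⁻¹)
    (fun i hi => sigmaSub_inv_mem_posRootsAt hα hI hσ he hi) i hi
  rwa [inv_inv] at this

end Greedy

/-! ### The simple roots at a point -/

section SimpleRootsAt

variable [Finite ι] {P : RootDatum ι X Y} {b : P.Base} {e : ℚ ⊗[ℤ] Y}

omit [Finite ι] in
lemma neg_mem_rootsAt {i : ι} (hi : i ∈ rootsAt P e) : P.reflectionPerm i i ∈ rootsAt P e :=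
  reflection_mem_rootsAt hi hi

/-- Otherwise the difference is a root of Φ_e; it or its negative is positive, so one of the two
simple roots decomposes. -/
lemma pairing_nonpos_of_mem_simpleRootsAt {i j : ι} (hi : i ∈ simpleRootsAt b e)
    (hj : j ∈ simpleRootsAt b e) (hij : i ≠ j) : P.pairingIn ℤ i j ≤ 0 := by
  have := isTorsionFree_character P
  have := isTorsionFree_cocharacter P
  by_contra! h
  obtain ⟨k, hk⟩ := P.root_sub_root_mem_of_pairingIn_pos h hij
  have hke : k ∈ rootsAt P e := mem_rootsAt_of_eq_add (m := -1) hi.1.1 hj.1.1 (by rw [hk]; module)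
  rcases isPos_or_isPos_neg b k with hp | hp
  · exact hi.2 ⟨j, hj.1, k, ⟨hke, hp⟩, by rw [hk]; abel⟩
  · exact hj.2 ⟨i, hi.1, _, ⟨neg_mem_rootsAt hke, hp⟩, by
      rw [root_reflectionPerm_self_eq_neg, hk]; abel⟩

/-- Vectors in an open half-space with no acute angle between any two of them are independent. The
half-space is given by the height `f`, the angles by a positive definite invariant form. -/
lemma linearIndepOn_simpleRootsAt : LinearIndepOn ℤ P.root (simpleRootsAt b e) := by
  have := isTorsionFree_character P
  have := isTorsionFree_cocharacter P
  have : Fintype ι := Fintype.ofFinite ι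
  let M₀ := Submodule.span ℤ (Set.range P.root)
  let v (i : simpleRootsAt b e) : M₀ := P.rootSpanMem ℤ i
  change LinearIndependent ℤ (M₀.subtype ∘ v)
  suffices LinearIndependent ℤ v by
    rwa [LinearMap.linearIndependent_iff_of_disjoint M₀.subtype (by simp)]
  let f : Module.Dual ℤ M₀ := b.toWeightBasisInt.constr ℤ fun _ => 1
  have hf : ∀ i, b.IsPos i → 0 < f (P.rootSpanMem ℤ i) := by
    have hf1 : ∀ i ∈ b.support, f (P.rootSpanMem ℤ i) = 1 := by
      intro i hi
      have h : P.rootSpanMem ℤ i = b.toWeightBasisInt ⟨i, hi⟩ :=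
        Subtype.ext (b.coe_toWeightBasisInt_apply ⟨i, hi⟩).symm
      rw [h]
      exact b.toWeightBasisInt.constr_basis ℤ _ _
    intro i hi
    refine hi.induction_on_add (p := fun i => 0 < f (P.rootSpanMem ℤ i))
      (fun i hi => by rw [hf1 i hi]; exact one_pos) fun i j k hk hi hj => ?_
    have h : P.rootSpanMem ℤ k = P.rootSpanMem ℤ i + P.rootSpanMem ℤ j := Subtype.ext hk
    rw [h, map_add, hf1 j hj]
    linarith
  obtain ⟨B, hB⟩ : ∃ B : P.RootPositiveForm ℤ, B.posForm.toQuadraticMap.PosDef :=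
    ⟨P.posRootForm ℤ, by simpa using P.posRootForm_rootFormIn_posDef ℤ⟩
  refine LinearMap.BilinForm.linearIndependent_of_pairwise_le_zero B.posForm hB f v
    (fun i => hf i i.2.1.2) ?_
  rintro ⟨i, hi⟩ ⟨j, hj⟩ hij
  rw [B.posForm_apply_root_root_le_zero_iff]
  exact pairing_nonpos_of_mem_simpleRootsAt hi hj fun h => hij (Subtype.ext h)

lemma exists_functional_simpleRootsAt (a : ι → ℚ) :
    ∃ f : X →+ ℚ, ∀ i ∈ simpleRootsAt b e, f (P.root i) = a i :=
  exists_functional linearIndepOn_simpleRootsAt a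

omit [Finite ι] in
-- Δ_e generates Φ_e, by induction on the height with respect to `b`: a non-simple member of Φ_e^+
-- is a sum of two members of smaller height.
lemma eq_on_rootsAt {f f' : X →+ ℚ} (h : ∀ i ∈ simpleRootsAt b e, f (P.root i) = f' (P.root i))
    {i : ι} (hi : i ∈ rootsAt P e) : f (P.root i) = f' (P.root i) := by
  have key : ∀ n : ℕ, ∀ i ∈ posRootsAt b e, b.height i = n → f (P.root i) = f' (P.root i) := by
    intro n
    induction n using Nat.strong_induction_on with
    | _ n ih =>
      intro i hi hn
      by_cases hs : i ∈ simpleRootsAt b e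
      · exact h i hs
      · have : ∃ j ∈ posRootsAt b e, ∃ k ∈ posRootsAt b e, P.root i = P.root j + P.root k := by
          by_contra hc
          exact hs ⟨hi, hc⟩
        obtain ⟨j, hj, k, hk, hjk⟩ := this
        have hadd := b.height_add hjk
        have hj' := b.isPos_iff.1 hj.2
        have hk' := b.isPos_iff.1 hk.2
        rw [hjk, map_add, map_add, ih (b.height j).toNat (by omega) j hj (by omega),
          ih (b.height k).toNat (by omega) k hk (by omega)]
  have key' : ∀ i ∈ posRootsAt b e, f (P.root i) = f' (P.root i) := fun i hi =>
    key (b.height i).toNat i hi (by have := b.isPos_iff.1 hi.2; omega)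
  rcases isPos_or_isPos_neg b i with hp | hp
  · exact key' i ⟨hi, hp⟩
  · have := key' _ ⟨neg_mem_rootsAt hi, hp⟩
    rw [root_reflectionPerm_self_eq_neg, map_neg, map_neg] at this
    exact neg_injective this

omit [Finite ι] in
-- Otherwise the pairing with α_i^∨ vanishes on Φ_e, but it is 2 at α_i.
lemma exists_simpleRootsAt_pairing_ne_zero (b : P.Base) {i : ι} (hi : i ∈ rootsAt P e) :
    ∃ k ∈ simpleRootsAt b e, P.pairing k i ≠ 0 := by
  by_contra! h
  have := eq_on_rootsAt (b := b) (f := corootFunctional P i) (f' := 0)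
    (fun k hk => by rw [corootFunctional_root, h k hk]; simp) hi
  rw [corootFunctional_root, RootPairing.pairing_same] at this
  norm_num at this

end SimpleRootsAt

/-! ### Twisted Coxeter elements have no fixed vectors in the root lattice -/

section Elliptic

variable {P : RootDatum ι X Y}

lemma reflection_smul_eq_self {i : ι} {x : X} (h : P.coroot' i x = 0) :
    Equiv.reflection P i • x = x := by
  rw [reflection_smul, h, zero_smul, sub_zero]

lemma wordProd_smul_eq_self {l : List ι} {x : X} (h : ∀ i ∈ l, P.coroot' i x = 0) :
    wordProd P l • x = x := by
  induction l with
  | nil => simp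
  | cons i l ih =>
    rw [wordProd_cons, mul_smul, ih fun j hj => h j (by simp [hj]),
      reflection_smul_eq_self (h i (by simp))]

/-- Only the letter j changes `f j`. So the hypothesis passes to the tail of the word, the tail
fixes x, and comparing `f j` then isolates the pairing with the head. -/
lemma coroot'_eq_zero_of_map_eq {A : Type*} {α : A → ι} {f : A → X →+ ℚ} {l : List A}
    (hl : l.Nodup) (h1 : ∀ j, f j (P.root (α j)) = 1)
    (h0 : ∀ j k, k ≠ j → f j (P.root (α k)) = 0) {x : X}
    (hx : ∀ j ∈ l, f j (wordProd P (l.map α) • x) = f j x) :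
    ∀ j ∈ l, P.coroot' (α j) x = 0 := by
  induction l with
  | nil => simp
  | cons j l ih =>
    rw [List.nodup_cons] at hl
    rw [List.map_cons, wordProd_cons] at hx
    have hrec : ∀ k ∈ l, P.coroot' (α k) x = 0 := by
      refine ih hl.2 fun k hk => ?_
      have hjk : j ≠ k := fun h => hl.1 (h ▸ hk)
      rw [← hx k (by simp [hk]), mul_smul, map_reflection_smul P (h0 k j hjk)]
    have hfix : wordProd P (l.map α) • x = x := by
      refine wordProd_smul_eq_self fun i hi => ?_
      obtain ⟨k, hk, rfl⟩ := List.mem_map.1 hi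
      exact hrec k hk
    intro k hk
    rcases List.mem_cons.1 hk with rfl | hk
    · have h := hx k (by simp)
      rw [mul_smul, hfix, reflection_smul, map_sub, map_zsmul, h1 k, sub_eq_self, zsmul_one] at h
      exact_mod_cast h
    · exact hrec k hk

lemma eq_zero_of_coroot'_eq_zero [Finite ι] (b : P.Base) {x : X} (hx : x ∈ P.rootSpan ℤ)
    (h : ∀ i ∈ b.support, P.coroot' i x = 0) : x = 0 := by
  have : Fintype ι := Fintype.ofFinite ι
  have hall : ∀ i, P.coroot' i x = 0 := by
    intro i
    have hle : Submodule.span ℤ (P.coroot '' b.support) ≤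
        LinearMap.ker (P.toLinearMap x) := by
      rw [Submodule.span_le]
      rintro _ ⟨j, hj, rfl⟩
      exact h j hj
    exact hle (b.coroot_mem_span_int i)
  refine P.eq_zero_of_mem_rootSpan_of_rootForm_self_eq_zero hx ?_
  rw [RootPairing.rootForm_apply_apply]
  exact Finset.sum_eq_zero fun i _ => by rw [hall i, zero_mul]

variable {b : P.Base} {σ : P.Aut} {r : ℕ} {α : Fin r → ι}
  (hσ : rootPerm P σ '' b.support = b.support) (hα : ∀ k, α k ∈ b.support)
  (hrep : ∀ i ∈ b.support, ∃! k, SameOrbit P σ i (α k))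

include hα hrep

lemma eq_of_sameOrbit {j k : Fin r} (h : SameOrbit P σ (α k) (α j)) : k = j :=
  (hrep _ (hα k)).unique (SameOrbit.refl _ _) h

include hσ

/-- The sum of the coefficients over the orbit of `α j`. -/
lemma exists_orbit_functional (j : Fin r) :
    ∃ f : X →+ ℚ, (∀ i, f (σ • P.root i) = f (P.root i)) ∧ f (P.root (α j)) = 1 ∧
      ∀ k, k ≠ j → f (P.root (α k)) = 0 := by
  classical
  obtain ⟨f, hf, hfσ⟩ := exists_invariant_functional b hσ
    (fun i => if SameOrbit P σ i (α j) then 1 else 0)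
    (fun i => by simp only [sameOrbit_rootPerm_iff])
  refine ⟨f, hfσ, ?_, fun k hk => ?_⟩
  · rw [hf _ (hα j), if_pos (SameOrbit.refl _ _)]
  · rw [hf _ (hα k), if_neg fun h => hk (eq_of_sameOrbit hα hrep h)]

/-- A twisted Coxeter element has no nonzero fixed vectors in the root lattice. -/
lemma eq_zero_of_coxeterProd_smul_eq [Finite ι] {x : X} (hx : x ∈ P.rootSpan ℤ)
    (hfix : (coxeterProd P α * σ) • x = x) : x = 0 := by
  choose f hfσ hf1 hf0 using exists_orbit_functional hσ hα hrep
  have hspan : ∀ j, f j (σ • x) = f j x := by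
    intro j
    have hle : P.rootSpan ℤ ≤ AddSubgroup.toIntSubmodule
        (((f j).comp (DistribSMul.toAddMonoidHom X σ)).eqLocus (f j)) := by
      rw [RootPairing.rootSpan, Submodule.span_le]
      rintro _ ⟨i, rfl⟩
      exact hfσ j i
    exact hle hx
  rw [mul_smul] at hfix
  -- The orbit sums `f j` are σ-invariant, so they agree at σx and at c(σx) = x.
  have hw : ∀ j, P.coroot' (α j) (σ • x) = 0 := by
    have h := coroot'_eq_zero_of_map_eq (l := List.finRange r) (List.nodup_finRange r) hf1 hf0
      (x := σ • x) fun j _ => ?_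
    · exact fun j => h j (List.mem_finRange j)
    · rw [← List.ofFn_eq_map, ← coxeterProd, hfix, hspan]
  have hσx : σ • x = x := by
    conv_rhs => rw [← hfix, coxeterProd]
    rw [wordProd_smul_eq_self]
    intro i hi
    obtain ⟨j, rfl⟩ := (List.mem_ofFn' _ _).1 hi
    exact hw j
  have hσm : ∀ m : ℤ, σ ^ m • x = x := fun m =>
    (MulAction.stabilizer P.Aut x).zpow_mem (show σ ∈ MulAction.stabilizer P.Aut x from hσx) m
  refine eq_zero_of_coroot'_eq_zero b hx fun i hi => ?_
  obtain ⟨j, hj, -⟩ := hrep i hi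
  obtain ⟨m, hm⟩ := hj
  rw [← coroot'_smul P (σ ^ m), hm, hσm, ← hσx]
  exact hw j

end Elliptic

/-! ### The twisted Coxeter element at a point -/

section CoxeterAt

variable {P : RootDatum ι X Y} {b : P.Base} {e : ℚ ⊗[ℤ] Y}
  {σ : P.Aut} {r : ℕ} {α : Fin r → ι} {I : Finset (Fin r)}

lemma map_subProd_smul {f : X →+ ℚ} (hf : ∀ k ∈ I, f (P.root (α k)) = 0) (x : X) :
    f (subProd P α I • x) = f x := by
  refine map_wordProd_smul P (fun i hi => ?_) x
  obtain ⟨k, hk, rfl⟩ := List.mem_map.1 hi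
  exact hf k (by simpa using hk)

lemma map_betaSub {f : X →+ ℚ} (hf : ∀ k ∈ I, f (P.root (α k)) = 0) (j : Fin r) :
    f (P.root (betaSub P α I j)) = f (P.root (α j)) := by
  rw [betaSub_eq, root_rootPerm, map_subProd_smul fun k hk => hf k (mem_below.1 hk).1]

variable (hσ : rootPerm P σ '' b.support = b.support) (hα : ∀ k, α k ∈ b.support)
  (hrep : ∀ i ∈ b.support, ∃! k, SameOrbit P σ i (α k))

include hσ hα hrep in
/-- The roots `β_j` lie in distinct orbits of `σ_{I,c}`. -/
lemma eq_of_sameOrbit_betaSub {j k : Fin r} (hj : j ∉ I)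
    (h : SameOrbit P (sigmaSub P σ α I) (betaSub P α I k) (betaSub P α I j)) : k = j := by
  obtain ⟨f, hfσ, hf1, hf0⟩ := exists_orbit_functional hσ hα hrep j
  have hI : ∀ k ∈ I, f (P.root (α k)) = 0 := fun k hk => hf0 k fun h => hj (h ▸ hk)
  have hinv : ∀ i, f (P.root (rootPerm P (sigmaSub P σ α I) i)) = f (P.root i) := fun i => by
    rw [root_rootPerm, sigmaSub, mul_smul, map_subProd_smul hI, hfσ]
  have := h.eq_of_invariant (F := fun i => f (P.root i)) hinv
  beta_reduce at this
  rw [map_betaSub hI, map_betaSub hI, hf1] at this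
  by_contra hkj
  rw [hf0 k hkj] at this
  exact zero_ne_one this

variable [Finite ι] [P.IsReduced] {μ : Y}
  (hI : ∀ j, j ∈ I ↔ betaSub P α I j ∉ rootsAt P e)
  (he : IsFixedPoint P (coxeterProd P α * σ) μ e)

include hσ hα hrep hI he

/-- Each orbit of `σ_{I,c}` on the simple roots at `e` contains some `β_j`. -/
lemma exists_sameOrbit_betaSub {i : ι} (hi : i ∈ simpleRootsAt b e) :
    ∃ j, j ∉ I ∧ SameOrbit P (sigmaSub P σ α I) i (betaSub P α I j) := by
  classical
  by_contra! hc
  set τ := sigmaSub P σ α I with hτ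
  -- The sum of the coefficients over the orbit of i. By assumption no β_j lies in this orbit, so
  -- every s_{β_j} preserves f.
  obtain ⟨f, hf⟩ := exists_functional_simpleRootsAt (P := P) (b := b) (e := e)
    (fun k => if SameOrbit P τ i k then 1 else 0)
  have hfτ : ∀ k ∈ rootsAt P e, f (τ • P.root k) = f (P.root k) := by
    intro k hk
    refine eq_on_rootsAt (b := b) (f := f.comp (DistribSMul.toAddMonoidHom X τ))
      (fun k hk => ?_) hk
    have hτk : rootPerm P τ k ∈ simpleRootsAt b e := by
      rw [← sigmaSub_image_simpleRootsAt hα hI hσ he]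
      exact ⟨k, hk, rfl⟩
    change f (τ • P.root k) = _
    rw [← root_rootPerm, hf _ hτk, hf _ hk]
    refine if_congr ?_ rfl rfl
    exact ⟨fun h => h.trans (sameOrbit_rootPerm τ k).symm,
      fun h => h.trans (sameOrbit_rootPerm τ k)⟩
  set g := coxeterProd P α * σ with hg
  have hfg : ∀ k ∈ rootsAt P e, f (g • P.root k) = f (P.root k) := by
    intro k hk
    rw [hg, ← coxeterSub_mul_sigmaSub (I := I), mul_smul, coxeterSub_eq, map_subProd_smul, hfτ k hk]
    intro j hj
    have hj : j ∉ I := by simpa using hj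
    rw [hf _ (betaSub_mem_simpleRootsAt hα hI hj), if_neg (hc j hj)]
  have hpow : ∀ m : ℕ, rootPerm P (g ^ m) i ∈ rootsAt P e ∧ f (g ^ m • P.root i) = 1 := by
    intro m
    induction m with
    | zero =>
      refine ⟨hi.1.1, ?_⟩
      rw [pow_zero, one_smul, hf i hi, if_pos (SameOrbit.refl _ _)]
    | succ m ih =>
      rw [pow_succ']
      refine ⟨he.rootPerm_mem ih.1, ?_⟩
      rw [mul_smul, ← root_rootPerm P (g ^ m), hfg _ ih.1, root_rootPerm, ih.2]
  let N := orderOf (rootPerm P g)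
  have hN : 0 < N := orderOf_pos _
  have hgN : g ^ N • P.root i = P.root i := by
    rw [← root_rootPerm, rootPerm, map_pow]
    change P.root ((rootPerm P g ^ N) i) = _
    rw [pow_orderOf_eq_one]
    rfl
  -- The sum over a full period of g is g-fixed, hence zero, although f takes the value N on it.
  have hzero : ∑ m ∈ Finset.range N, g ^ m • P.root i = 0 := by
    refine eq_zero_of_coxeterProd_smul_eq hσ hα hrep ?_ ?_
    · refine Submodule.sum_mem _ fun m _ => ?_
      rw [← root_rootPerm]
      exact Submodule.subset_span ⟨_, rfl⟩
    · rw [← hg, Finset.smul_sum]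
      have h1 := Finset.sum_range_succ (fun m => g ^ m • P.root i) N
      have h2 := Finset.sum_range_succ' (fun m => g ^ m • P.root i) N
      rw [h1, hgN, pow_zero, one_smul] at h2
      simp only [smul_smul, ← pow_succ']
      exact (add_right_cancel h2).symm
  have hsum := congrArg f hzero
  rw [map_sum, map_zero, Finset.sum_congr rfl fun m _ => (hpow m).2] at hsum
  simp at hsum
  omega

/-- `Δ_{I,c}` is a set of representatives of the orbits of `σ_{I,c}` on the simple roots
at `e`. -/
lemma existsUnique_mem_deltaSub {i : ι} (hi : i ∈ simpleRootsAt b e) :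
    ∃! j, j ∈ deltaSub P α I ∧ SameOrbit P (sigmaSub P σ α I) i j := by
  obtain ⟨j, hj, hij⟩ := exists_sameOrbit_betaSub hσ hα hrep hI he hi
  refine ⟨_, ⟨⟨j, hj, rfl⟩, hij⟩, ?_⟩
  rintro _ ⟨⟨k, hk, rfl⟩, hik⟩
  rw [eq_of_sameOrbit_betaSub hσ hα hrep hj (hik.symm.trans hij)]

lemma isCoxeterElement_coxeterSub :
    IsCoxeterElement P (simpleRootsAt b e) (sigmaSub P σ α I) (coxeterSub P α I) := by
  classical
  have hmem : ∀ i ∈ (Iᶜ.sort (· ≤ ·)).map (betaSub P α I), ∃ j, j ∉ I ∧ betaSub P α I j = i := by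
    intro i hi
    obtain ⟨j, hj, rfl⟩ := List.mem_map.1 hi
    exact ⟨j, by simpa using hj, rfl⟩
  have hsimple : ∀ i ∈ (Iᶜ.sort (· ≤ ·)).map (betaSub P α I), i ∈ simpleRootsAt b e := by
    intro i hi
    obtain ⟨j, hj, rfl⟩ := hmem i hi
    exact betaSub_mem_simpleRootsAt hα hI hj
  have hnodup : ((Iᶜ.sort (· ≤ ·)).map (betaSub P α I)).Nodup := by
    refine List.Nodup.map_on (fun j hj k hk h => ?_) (Finset.sort_nodup _ _)
    have hk : k ∉ I := by simpa using hk
    exact eq_of_sameOrbit_betaSub hσ hα hrep hk (by rw [h]; exact SameOrbit.refl _ _)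
  refine ⟨(Iᶜ.sort (· ≤ ·)).map (betaSub P α I), ⟨hsimple, rfl, fun l' hl' hw => ?_⟩,
    fun i hi => ?_⟩
  -- Every word for c_I contains each letter x of the given one: otherwise the coordinate at x would
  -- distinguish the two products.
  · refine (hnodup.subperm fun x hx => ?_).length_le
    by_contra hx'
    obtain ⟨f, hf⟩ := exists_functional_simpleRootsAt (P := P) (b := b) (e := e)
      (fun k => if k = x then 1 else 0)
    obtain ⟨l₁, l₂, hl⟩ := List.append_of_mem hx
    rw [hl] at hnodup hsimple
    have h0 : ∀ l : List ι, (∀ i ∈ l, i ∈ simpleRootsAt b e) → x ∉ l →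
        ∀ i ∈ l, f (P.root i) = 0 := fun l hl hxl i hi => by
      rw [hf i (hl i hi), if_neg (by rintro rfl; exact hxl hi)]
    have hx1 : x ∉ l₁ ∧ x ∉ l₂ := by
      rw [List.nodup_append] at hnodup
      refine ⟨fun h => hnodup.2.2 x h x (by simp) rfl, (List.nodup_cons.1 hnodup.2.1).1⟩
    refine exists_wordProd_ne P (f := f) (k := x) (l₁ := l₁) (l₂ := l₂) (l' := l') ?_
      (h0 l₁ (fun i hi => hsimple i (by simp [hi])) hx1.1)
      (h0 l₂ (fun i hi => hsimple i (by simp [hi])) hx1.2) (h0 l' hl' hx') ?_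
    · rw [hf x (hsimple x (by simp)), if_pos rfl]
      exact one_ne_zero
    · rw [← hl, hw]
      rfl
  · obtain ⟨j, hj, hij⟩ := exists_sameOrbit_betaSub hσ hα hrep hI he hi
    have hjl : betaSub P α I j ∈ (Iᶜ.sort (· ≤ ·)).map (betaSub P α I) :=
      List.mem_map.2 ⟨j, by simpa using hj, rfl⟩
    obtain ⟨k, hk⟩ := List.get_of_mem hjl
    refine ⟨k, by beta_reduce; rwa [hk], fun k' hk' => ?_⟩
    obtain ⟨j', hj', h'⟩ := hmem _ (List.get_mem _ k')
    beta_reduce at hk'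
    rw [← h'] at hk'
    have hjj := eq_of_sameOrbit_betaSub hσ hα hrep hj (hk'.symm.trans hij)
    apply List.nodup_iff_injective_get.1 hnodup
    rw [hk, ← h', hjj]

end CoxeterAt

/-! ### Orthogonal decompositions and elements of the Weyl group -/

section Weyl

variable {P : RootDatum ι X Y}

lemma map_eq_zero_of_mem_closure {S : Set X} {f : X →+ ℚ} (hf : ∀ x ∈ S, f x = 0) {x : X}
    (hx : x ∈ AddSubgroup.closure S) : f x = 0 :=
  (AddSubgroup.closure_le f.ker).2 hf hx

lemma pairing_eq_zero_of_mem_closure {N : Set ι} {i j : ι} (h : ∀ k ∈ N, P.pairing k j = 0)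
    (hi : P.root i ∈ AddSubgroup.closure (P.root '' N)) : P.pairing i j = 0 := by
  have := map_eq_zero_of_mem_closure (f := corootFunctional P j) (by
    rintro _ ⟨k, hk, rfl⟩
    rw [corootFunctional_root, h k hk, Int.cast_zero]) hi
  rw [corootFunctional_root] at this
  exact_mod_cast this

lemma rootPerm_reflection_eq_self {i j : ι} (h : P.pairing i j = 0) :
    rootPerm P (Equiv.reflection P j) i = i := by
  apply P.root.injective
  rw [root_rootPerm, reflection_smul_root, h, zero_smul, sub_zero]

lemma reflection_smul_mem_closure {N : Set ι} {j : ι} (hj : j ∈ N) {x : X}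
    (hx : x ∈ AddSubgroup.closure (P.root '' N)) :
    Equiv.reflection P j • x ∈ AddSubgroup.closure (P.root '' N) := by
  rw [reflection_smul]
  exact sub_mem hx (zsmul_mem (AddSubgroup.subset_closure (Set.mem_image_of_mem _ hj)) _)

variable [Finite ι] [P.IsReduced] {b : P.Base}

/-- If the simple roots decompose into two orthogonal sets, each root lies in the span of one of
the two. -/
lemma root_mem_closure_or {N Z : Set ι} (hNZ : ∀ i ∈ b.support, i ∈ N ∨ i ∈ Z)
    (horth : ∀ i ∈ N, ∀ j ∈ Z, P.pairing i j = 0) (i : ι) :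
    P.root i ∈ AddSubgroup.closure (P.root '' N) ∨
      P.root i ∈ AddSubgroup.closure (P.root '' Z) := by
  have horth' : ∀ i ∈ Z, ∀ j ∈ N, P.pairing i j = 0 := fun i hi j hj =>
    (pairing_eq_zero_comm P).1 (horth j hj i hi)
  refine b.induction_reflect i (p := fun i => P.root i ∈ AddSubgroup.closure (P.root '' N) ∨
    P.root i ∈ AddSubgroup.closure (P.root '' Z)) (fun i hi => ?_) (fun i hi => ?_)
    (fun i j hi hj => ?_)
  · simpa only [root_reflectionPerm_self_eq_neg, neg_mem_iff] using hi
  · exact (hNZ i hi).imp (fun h => AddSubgroup.subset_closure (Set.mem_image_of_mem _ h))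
      (fun h => AddSubgroup.subset_closure (Set.mem_image_of_mem _ h))
  · rw [← rootPerm_reflection]
    rcases hi with hi | hi <;> rcases hNZ j hj with hj | hj
    · rw [root_rootPerm]
      exact .inl (reflection_smul_mem_closure hj hi)
    · rw [rootPerm_reflection_eq_self
        (pairing_eq_zero_of_mem_closure (fun k hk => horth k hk j hj) hi)]
      exact .inl hi
    · rw [rootPerm_reflection_eq_self
        (pairing_eq_zero_of_mem_closure (fun k hk => horth' k hk j hj) hi)]
      exact .inr hi
    · rw [root_rootPerm]
      exact .inr (reflection_smul_mem_closure hj hi)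

lemma SameComponent.root_mem_closure_iff {N Z : Set ι} (hNZ : ∀ i ∈ b.support, i ∈ N ∨ i ∈ Z)
    (horth : ∀ i ∈ N, ∀ j ∈ Z, P.pairing i j = 0) {i j : ι} (h : SameComponent P i j) :
    P.root i ∈ AddSubgroup.closure (P.root '' N) ↔
      P.root j ∈ AddSubgroup.closure (P.root '' N) := by
  have key : ∀ i j, P.pairing i j ≠ 0 → P.root i ∈ AddSubgroup.closure (P.root '' N) →
      P.root j ∈ AddSubgroup.closure (P.root '' N) := by
    intro i j hij hi
    refine (root_mem_closure_or hNZ horth j).resolve_right fun hj => hij ?_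
    refine pairing_eq_zero_of_mem_closure (fun k hk => ?_) hi
    exact (pairing_eq_zero_comm P).1 (pairing_eq_zero_of_mem_closure
      (fun z hz => (pairing_eq_zero_comm P).1 (horth k hk z hz)) hj)
  induction h with
  | rel i j h => exact ⟨key i j h, key j i (mt (pairing_eq_zero_comm P).1 h)⟩
  | refl => rfl
  | symm _ _ _ ih => exact ih.symm
  | trans _ _ _ _ _ ih ih' => exact ih.trans ih'

/-- The exchange property. -/
lemma exists_of_not_isPos {L : List ι} (hL : ∀ j ∈ L, j ∈ b.support) {i : ι} (hi : b.IsPos i)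
    (h : ¬ b.IsPos (rootPerm P (wordProd P L) i)) :
    ∃ L₁ m L₂, L = L₁ ++ m :: L₂ ∧ rootPerm P (wordProd P L₂) i = m := by
  induction L with
  | nil => exact absurd hi h
  | cons m L ih =>
    by_cases hp : b.IsPos (rootPerm P (wordProd P L) i)
    · refine ⟨[], m, L, rfl, ?_⟩
      by_contra hne
      exact h (hp.reflectionPerm (hL m (by simp)) hne)
    · obtain ⟨L₁, m', L₂, rfl, h'⟩ := ih (fun j hj => hL j (by simp [hj])) hp
      exact ⟨m :: L₁, m', L₂, rfl, h'⟩

/-- An element of the Weyl group that preserves the positive roots of a union of components acts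
trivially on it. -/
lemma rootPerm_wordProd_eq_self {Γ : Set ι}
    (hΓ : ∀ i j, SameComponent P i j → i ∈ Γ → j ∈ Γ) {L : List ι}
    (hL : ∀ j ∈ L, j ∈ b.support)
    (hpos : ∀ i ∈ Γ, b.IsPos i → b.IsPos (rootPerm P (wordProd P L) i)) :
    ∀ i ∈ Γ, rootPerm P (wordProd P L) i = i := by
  obtain ⟨n, hn⟩ : ∃ n, L.length = n := ⟨_, rfl⟩
  induction n using Nat.strong_induction_on generalizing L with
  | _ n ih =>
    rcases List.eq_nil_or_concat L with rfl | ⟨L', i, rfl⟩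
    · simp
    · simp only [List.concat_eq_append] at hn hL hpos ⊢
      have hL' : ∀ j ∈ L', j ∈ b.support := fun j hj => hL j (by simp [hj])
      have hi : i ∈ b.support := hL i (by simp)
      rw [List.length_append, List.length_singleton] at hn
      have hprod : wordProd P (L' ++ [i]) = wordProd P L' * Equiv.reflection P i := by
        rw [wordProd_append, wordProd_cons, wordProd_nil, mul_one]
      by_cases hiΓ : i ∈ Γ
      · have h1 := hpos i hiΓ (RootPairing.Base.isPos_of_mem_support hi)
        have h2 : ¬ b.IsPos (rootPerm P (wordProd P L') i) := by
          refine (RootPairing.Base.IsPos.neg_iff_not b _).1 ?_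
          convert h1 using 1
          apply P.root.injective
          rw [hprod, rootPerm_mul, root_rootPerm, root_rootPerm, reflection_smul_root_self,
            smul_neg, ← root_rootPerm]
          exact root_reflectionPerm_self_eq_neg _
        obtain ⟨L₁, m, L₂, rfl, hm⟩ := exists_of_not_isPos hL'
          (RootPairing.Base.isPos_of_mem_support hi) h2
        -- The exchange property cancels the last letter against an earlier one, which shortens the
        -- word by two.
        have heq : wordProd P ((L₁ ++ m :: L₂) ++ [i]) = wordProd P (L₁ ++ L₂) := by
          rw [hprod, wordProd_append, wordProd_append, wordProd_cons, ← hm, ← conj_reflection]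
          rw [mul_assoc, mul_assoc, mul_assoc, mul_assoc, inv_mul_cancel_left, reflection_mul_self,
            mul_one]
        rw [heq] at hpos ⊢
        refine ih (L₁ ++ L₂).length ?_ (fun j hj => hL' j ?_) hpos rfl
        · simp only [List.length_append, List.length_cons] at hn ⊢
          omega
        · simp only [List.mem_append, List.mem_cons] at hj ⊢
          tauto
      · have hfix : ∀ j ∈ Γ, rootPerm P (wordProd P (L' ++ [i])) j =
            rootPerm P (wordProd P L') j := by
          intro j hj
          rw [hprod, rootPerm_mul, rootPerm_reflection_eq_self]
          by_contra h
          exact hiΓ (hΓ j i (.rel _ _ h) hj)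
        intro j hj
        rw [hfix j hj]
        refine ih L'.length (by omega) hL' (fun k hk hkp => ?_) rfl j hj
        rw [← hfix k hk]
        exact hpos k hk hkp

end Weyl

/-! ### Splitting off the initial letters -/

section Split

variable {P : RootDatum ι X Y}

lemma exists_first_or {A : Type*} (l : List A) (q : A → Prop) :
    (∀ j ∈ l, ¬ q j) ∨ ∃ l₁ j l₂, l = l₁ ++ j :: l₂ ∧ q j ∧ ∀ k ∈ l₁, ¬ q k := by
  induction l with
  | nil => simp
  | cons a l ih =>
    by_cases ha : q a
    · exact .inr ⟨[], a, l, rfl, ha, by simp⟩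
    · rcases ih with ih | ⟨l₁, j, l₂, rfl, hj, h⟩
      · exact .inl (by simpa [ha] using ih)
      · exact .inr ⟨a :: l₁, j, l₂, rfl, hj, by simpa [ha] using h⟩

/-- Letters from Z that commute with everything remaining before them are collected in `u`. Each
letter from Z left in `v` is blocked by an earlier non-orthogonal letter. -/
lemma exists_split [Finite ι] (l : List ι) (Z : ι → Prop) :
    ∃ u v, wordProd P l = wordProd P u * wordProd P v ∧ (u ++ v).Perm l ∧ (∀ i ∈ u, Z i) ∧
      ∀ v₁ i v₂, v = v₁ ++ i :: v₂ → Z i → ∃ j ∈ v₁, P.pairing j i ≠ 0 := by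
  induction l using List.reverseRecOn with
  | nil => exact ⟨[], [], by simp, by simp, by simp, by simp⟩
  | append_singleton l i ih =>
    obtain ⟨u, v, hprod, hperm, hu, hv⟩ := ih
    by_cases h : Z i ∧ ∀ j ∈ v, P.pairing j i = 0
    · refine ⟨u ++ [i], v, ?_, ?_, ?_, hv⟩
      · have h1 := conj_reflection P (wordProd P v) i
        have h2 : rootPerm P (wordProd P v) i = i := by
          apply P.root.injective
          rw [root_rootPerm, wordProd_smul_eq_self]
          intro j hj
          exact (pairing_eq_zero_comm P).1 (h.2 j hj)
        rw [h2, mul_inv_eq_iff_eq_mul] at h1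
        rw [wordProd_append, hprod, wordProd_append, wordProd_cons, wordProd_nil, mul_one, mul_assoc,
          h1, mul_assoc]
      · rw [List.append_assoc]
        refine List.Perm.trans ?_ (hperm.append_right [i])
        rw [List.append_assoc]
        exact List.perm_append_comm.append_left u
      · intro j hj
        rcases List.mem_append.1 hj with hj | hj
        · exact hu j hj
        · rw [List.mem_singleton.1 hj]
          exact h.1
    · refine ⟨u, v ++ [i], ?_, ?_, hu, ?_⟩
      · rw [wordProd_append, hprod, wordProd_append, mul_assoc]
      · rw [← List.append_assoc]
        exact hperm.append_right [i]
      · intro v₁ k v₂ hvk hZ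
        rcases List.eq_nil_or_concat v₂ with rfl | ⟨v₃, m, rfl⟩
        · obtain ⟨rfl, hk⟩ := List.append_inj' hvk rfl
          obtain rfl : i = k := by simpa using hk
          by_contra! hc
          exact h ⟨hZ, hc⟩
        · rw [List.concat_eq_append, ← List.cons_append, ← List.append_assoc] at hvk
          obtain ⟨hvk, -⟩ := List.append_inj' hvk rfl
          exact hv v₁ k v₃ hvk hZ

end Split

/-! ### Conjugates of a twisted Coxeter element and invariant dominant functionals -/

section Configuration

variable {P : RootDatum ι X Y}

/-- The list `l` contains exactly one element from each `σ`-orbit on the simple roots. -/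
structure IsTransversal (b : P.Base) (σ : P.Aut) (l : List ι) : Prop where
  mem_support : ∀ i ∈ l, i ∈ b.support
  pairwise : l.Pairwise fun i j => ¬ SameOrbit P σ i j
  exists_mem : ∀ i ∈ b.support, ∃ j ∈ l, SameOrbit P σ i j

/-- The conjugate of `g` by `w` is a twisted Coxeter element, with word `l`, and `p` is a dominant
functional that is invariant under the conjugate of `τ`. -/
structure IsConfiguration (b : P.Base) (σ g τ w : P.Aut) (l : List ι) (p : X →+ ℚ) : Prop where
  transversal : IsTransversal b σ l
  conj : w⁻¹ * g * w = wordProd P l * σ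
  invariant : ∀ i, p ((w⁻¹ * τ * w) • P.root i) = p (P.root i)
  nonneg : ∀ i ∈ b.support, 0 ≤ p (P.root i)

variable {b : P.Base} {σ : P.Aut}

lemma IsTransversal.eq_of_sameOrbit {l : List ι} (h : IsTransversal b σ l) {i j : ι} (hi : i ∈ l)
    (hj : j ∈ l) (hij : SameOrbit P σ i j) : i = j := by
  by_contra hne
  have : Std.Symm fun i j => ¬ SameOrbit P σ i j := ⟨fun _ _ h h' => h h'.symm⟩
  exact h.pairwise.forall hi hj hne hij

lemma IsTransversal.nodup {l : List ι} (h : IsTransversal b σ l) : l.Nodup :=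
  h.pairwise.imp fun {a b} hij heq => hij (by rw [heq]; exact SameOrbit.refl _ _)

lemma IsTransversal.perm {l l' : List ι} (h : IsTransversal b σ l) (hl : l.Perm l') :
    IsTransversal b σ l' where
  mem_support i hi := h.mem_support i (hl.mem_iff.2 hi)
  pairwise := (hl.pairwise_iff fun h h' => h h'.symm).1 h.pairwise
  exists_mem i hi := by
    obtain ⟨j, hj, hij⟩ := h.exists_mem i hi
    exact ⟨j, hl.mem_iff.1 hj, hij⟩

/-- This is the effect of conjugation by u: u⁻¹ (u v σ) u = v σ(u) σ. -/
lemma IsTransversal.rotate (hσ : rootPerm P σ '' b.support = b.support) {u v : List ι}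
    (h : IsTransversal b σ (u ++ v)) : IsTransversal b σ (v ++ u.map (rootPerm P σ)) := by
  have h := h.perm List.perm_append_comm
  refine ⟨fun i hi => ?_, ?_, fun i hi => ?_⟩
  · rcases List.mem_append.1 hi with hi | hi
    · exact h.mem_support i (by simp [hi])
    · obtain ⟨j, hj, rfl⟩ := List.mem_map.1 hi
      exact (rootPerm_mem_support_iff hσ).2 (h.mem_support j (by simp [hj]))
  · have hp := List.pairwise_append.1 h.pairwise
    refine List.pairwise_append.2 ⟨hp.1, ?_, fun i hi j hj => ?_⟩
    · refine List.pairwise_map.2 (hp.2.1.imp fun h h' => h ?_)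
      exact (sameOrbit_rootPerm_iff.1 h').trans (sameOrbit_rootPerm _ _).symm
    · obtain ⟨k, hk, rfl⟩ := List.mem_map.1 hj
      exact fun h' => hp.2.2 i hi k hk (h'.trans (sameOrbit_rootPerm _ _).symm)
  · obtain ⟨j, hj, hij⟩ := h.exists_mem i hi
    rcases List.mem_append.1 hj with hj | hj
    · exact ⟨j, by simp [hj], hij⟩
    · exact ⟨rootPerm P σ j, List.mem_append_right _ (List.mem_map_of_mem hj),
        hij.trans (sameOrbit_rootPerm _ _)⟩

lemma mem_of_sameOrbit {S : Set ι} (hS : ∀ i, rootPerm P σ i ∈ S ↔ i ∈ S) {i j : ι}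
    (h : SameOrbit P σ i j) (hi : i ∈ S) : j ∈ S := by
  have := h.eq_of_invariant (F := fun i => i ∈ S) fun i => propext (hS i)
  exact this ▸ hi

variable [Finite ι] [P.IsReduced] (hσ : rootPerm P σ '' b.support = b.support)

omit [P.IsReduced] in
/-- The inverse of the product of a word with distinct letters, applied to a simple root that is
orthogonal to the letters before the letter `j`. -/
lemma pos_map_wordProd_inv {v₁ v₂ : List ι} {i j : ι} {φ : X →+ ℚ}
    (hv : ∀ k ∈ v₁ ++ j :: v₂, k ∈ b.support) (hnodup : (v₁ ++ j :: v₂).Nodup)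
    (hi : i ∈ b.support) (hij : i ≠ j) (hp : P.pairing j i ≠ 0)
    (h₁ : ∀ k ∈ v₁, P.pairing k i = 0) (hφ : φ (P.root j) = 1)
    (hφ0 : ∀ k ∈ b.support, k ≠ j → φ (P.root k) = 0) :
    0 < φ ((wordProd P (v₁ ++ j :: v₂))⁻¹ • P.root i) := by
  have := isTorsionFree_character P
  have := isTorsionFree_cocharacter P
  have hj : j ∉ v₁ ∧ j ∉ v₂ := by
    rw [List.nodup_append] at hnodup
    exact ⟨fun h => hnodup.2.2 j h j (by simp) rfl, (List.nodup_cons.1 hnodup.2.1).1⟩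
  have hfix : (wordProd P v₁)⁻¹ • P.root i = P.root i := by
    rw [inv_smul_eq_iff, wordProd_smul_eq_self]
    exact fun k hk => (pairing_eq_zero_comm P).1 (h₁ k hk)
  have hle := b.pairingIn_le_zero_of_ne hij hi (hv j (by simp))
  rw [pairingIn_int] at hle
  have hne : P.pairing i j ≠ 0 := mt (pairing_eq_zero_comm P).1 hp
  -- The letters before j fix α_i, s_j adds a positive multiple of α_j, and the later letters do not
  -- change the coefficient of α_j.
  have hlt : P.pairing i j < 0 := lt_of_le_of_ne hle hne
  rw [wordProd_append, wordProd_cons, mul_inv_rev, mul_inv_rev, mul_smul, mul_smul, hfix,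
    RootPairing.Equiv.reflection_inv, map_wordProd_inv_smul, reflection_smul_root, map_sub,
    map_zsmul, hφ, hφ0 i hi hij, zero_sub, zsmul_one]
  · rw [← Int.cast_neg]
    exact Int.cast_pos.2 (by omega)
  · exact fun k hk => hφ0 k (hv k (by simp [hk])) (by rintro rfl; exact hj.2 hk)

omit [P.IsReduced] in
/-- For a word `v` in which no letter from `Z` can be moved to the front, the inverse of the product
maps the simple roots in `Z` to positive roots. -/
lemma isPos_wordProd_inv {v : List ι} (hv : ∀ k ∈ v, k ∈ b.support) (hnodup : v.Nodup)
    {Z : ι → Prop} (hZ : ∀ v₁ i v₂, v = v₁ ++ i :: v₂ → Z i → ∃ j ∈ v₁, P.pairing j i ≠ 0)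
    {i : ι} (hi : i ∈ b.support) (hiZ : Z i) : b.IsPos (rootPerm P (wordProd P v)⁻¹ i) := by
  classical
  rcases exists_first_or v (fun j => P.pairing j i ≠ 0) with h | ⟨v₁, j, v₂, rfl, hj, h⟩
  · have : rootPerm P (wordProd P v)⁻¹ i = i := by
      apply P.root.injective
      rw [root_rootPerm, inv_smul_eq_iff, wordProd_smul_eq_self]
      exact fun k hk => (pairing_eq_zero_comm P).1 (not_not.1 (h k hk))
    rw [this]
    exact RootPairing.Base.isPos_of_mem_support hi
  -- If j were i, this letter from Z would have only orthogonal letters before it, which `hZ`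
  -- excludes.
  · have hij : i ≠ j := by
      rintro rfl
      obtain ⟨k, hk, hki⟩ := hZ v₁ i v₂ rfl hiZ
      exact h k hk hki
    obtain ⟨φ, hφ⟩ := exists_functional_base b (fun k => if k = j then 1 else 0)
    have hφj : φ (P.root j) = 1 := by rw [hφ j (hv j (by simp)), if_pos rfl]
    have hφ0 : ∀ k ∈ b.support, k ≠ j → φ (P.root k) = 0 := fun k hk hkj => by
      rw [hφ k hk, if_neg hkj]
    refine isPos_of_map_pos (f := φ) (fun k hk => ?_) ?_
    · rw [hφ k hk]
      split_ifs <;> norm_num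
    · rw [root_rootPerm]
      exact pos_map_wordProd_inv hv hnodup hi hij hj (fun k hk => not_not.1 (h k hk)) hφj hφ0

/-- The simple roots where a functional vanishes. -/
def zeroSet (b : P.Base) (p : X →+ ℚ) : Set ι := {i | i ∈ b.support ∧ p (P.root i) = 0}

include hσ

omit [P.IsReduced] in
/-- From a configuration one obtains another one whose zero set consists of the members of the
zero set at which some functional vanishes. -/
lemma IsConfiguration.exists_next {g τ w : P.Aut} {l : List ι} {p : X →+ ℚ}
    (hc : IsConfiguration b σ g τ w l p) (hcomm : Commute g τ) {u v : List ι}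
    (hprod : wordProd P l = wordProd P u * wordProd P v) (hperm : (u ++ v).Perm l)
    (hu : ∀ i ∈ u, i ∈ zeroSet b p)
    (hv : ∀ v₁ i v₂, v = v₁ ++ i :: v₂ → i ∈ zeroSet b p → ∃ j ∈ v₁, P.pairing j i ≠ 0) :
    ∃ p', IsConfiguration b σ g τ (w * wordProd P u) (v ++ u.map (rootPerm P σ)) p' ∧
      zeroSet b p' = {i ∈ zeroSet b p | p ((wordProd P v * σ)⁻¹ • P.root i) = 0} := by
  set h := wordProd P v * σ with hh
  have htr := hc.transversal.perm hperm.symm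
  have hvsupp : ∀ k ∈ v, k ∈ b.support := fun k hk => htr.mem_support k (by simp [hk])
  have hvnodup : v.Nodup := (List.nodup_append.1 htr.nodup).2.1
  let y : X →+ ℚ := p.comp (DistribSMul.toAddMonoidHom X h⁻¹)
  have hy : ∀ x, y x = p (h⁻¹ • x) := fun x => rfl
  have hyZ : ∀ i ∈ zeroSet b p, 0 ≤ y (P.root i) := by
    intro i hi
    rw [hy, ← root_rootPerm]
    refine map_nonneg_of_isPos hc.nonneg ?_
    rw [hh, mul_inv_rev, rootPerm_mul, ← isPos_rootPerm_iff hσ, rootPerm_self_inv]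
    exact isPos_wordProd_inv hvsupp hvnodup hv hi.1 hi
  obtain ⟨M, hM0, hM⟩ := exists_mul_ge (S := b.support) (fun i => -y (P.root i))
    (fun i => p (P.root i))
  -- A large M keeps p' positive off the zero set of p; on the zero set only y counts.
  let p' : X →+ ℚ := (AddMonoidHom.mulLeft M).comp p + y
  have hp' : ∀ x, p' x = M * p x + y x := fun x => rfl
  have hpos : ∀ i ∈ b.support, i ∉ zeroSet b p → 0 < p' (P.root i) := by
    intro i hi hiZ
    have h0 : 0 < p (P.root i) := lt_of_le_of_ne (hc.nonneg i hi) fun h => hiZ ⟨hi, h.symm⟩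
    rw [hp']
    linarith [hM i hi h0]
  have hzero : ∀ i ∈ zeroSet b p, p' (P.root i) = y (P.root i) := by
    intro i hi
    rw [hp', hi.2, mul_zero, zero_add]
  have hconj : (w * wordProd P u)⁻¹ * g * (w * wordProd P u) = h * wordProd P u := by
    rw [mul_inv_rev]
    calc (wordProd P u)⁻¹ * w⁻¹ * g * (w * wordProd P u)
        = (wordProd P u)⁻¹ * (w⁻¹ * g * w) * wordProd P u := by group
      _ = h * wordProd P u := by rw [hc.conj, hprod, hh]; group
  have hpu : ∀ x, p (wordProd P u • x) = p x := map_wordProd_smul P fun i hi => (hu i hi).2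
  have hpu' : ∀ x, p ((wordProd P u)⁻¹ • x) = p x := map_wordProd_inv_smul P fun i hi => (hu i hi).2
  have hτ : (w * wordProd P u)⁻¹ * τ * (w * wordProd P u) =
      (wordProd P u)⁻¹ * (w⁻¹ * τ * w) * wordProd P u := by group
  have hinv : ∀ i, p (((w * wordProd P u)⁻¹ * τ * (w * wordProd P u)) • P.root i) =
      p (P.root i) := by
    intro i
    rw [hτ, mul_smul, mul_smul, hpu', ← root_rootPerm, hc.invariant, root_rootPerm, hpu]
  -- From w⁻¹ g w = u h and the commutation of g with τ; it makes y invariant under the new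
  -- conjugate of τ.
  have hcomm' : h⁻¹ * ((w * wordProd P u)⁻¹ * τ * (w * wordProd P u)) =
      (w⁻¹ * τ * w) * h⁻¹ := by
    have h1 : h⁻¹ = w⁻¹ * g⁻¹ * w * wordProd P u := by
      have hG : w⁻¹ * g * w = wordProd P u * h := by rw [hc.conj, hprod, hh, mul_assoc]
      calc h⁻¹ = (wordProd P u * h)⁻¹ * wordProd P u := by group
        _ = _ := by rw [← hG]; group
    calc h⁻¹ * ((w * wordProd P u)⁻¹ * τ * (w * wordProd P u))
        = w⁻¹ * (g⁻¹ * τ) * w * wordProd P u := by rw [h1]; group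
      _ = w⁻¹ * τ * w * h⁻¹ := by rw [hcomm.inv_left.eq, h1]; group
  refine ⟨p', ⟨htr.rotate hσ, ?_, fun i => ?_, fun i hi => ?_⟩, ?_⟩
  · rw [hconj, hh, wordProd_append, ← conj_wordProd]
    group
  · rw [hp', hp', hinv, hy, hy, ← mul_smul, hcomm', mul_smul, ← root_rootPerm P h⁻¹, hc.invariant]
  · by_cases hiZ : i ∈ zeroSet b p
    · rw [hzero i hiZ]
      exact hyZ i hiZ
    · exact (hpos i hi hiZ).le
  · ext i
    constructor
    · rintro ⟨hi, hpi⟩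
      have hiZ : i ∈ zeroSet b p := by
        by_contra hiZ
        exact (hpos i hi hiZ).ne' hpi
      rw [hzero i hiZ] at hpi
      exact ⟨hiZ, hpi⟩
    · rintro ⟨hi, hyi⟩
      exact ⟨hi.1, by rw [hzero i hi]; exact hyi⟩

omit [P.IsReduced] in
/-- For a configuration with a minimal zero set, the zero set is stable under `σ` and orthogonal to
the other simple roots. -/
lemma IsConfiguration.zeroSet_of_minimal {g τ w : P.Aut} {l : List ι} {p : X →+ ℚ}
    (hc : IsConfiguration b σ g τ w l p) (hcomm : Commute g τ)
    (hmin : ∀ u l' p', (∀ i ∈ u, i ∈ b.support) → IsConfiguration b σ g τ (w * wordProd P u) l' p' →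
      zeroSet b p' ⊆ zeroSet b p → zeroSet b p' = zeroSet b p) :
    (∀ i, rootPerm P σ i ∈ zeroSet b p ↔ i ∈ zeroSet b p) ∧
      ∀ i ∈ b.support, i ∉ zeroSet b p → ∀ j ∈ zeroSet b p, P.pairing i j = 0 := by
  classical
  obtain ⟨u, v, hprod, hperm, hu, hv⟩ := exists_split (P := P) l (· ∈ zeroSet b p)
  obtain ⟨p', hc', hp'⟩ := hc.exists_next hσ hcomm hprod hperm hu hv
  have heq := hmin u _ p' (fun i hi => (hu i hi).1) hc' (by rw [hp']; exact Set.sep_subset _ _)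
  set Z := zeroSet b p with hZdef
  -- By minimality the zero set cannot shrink, so the translate of p vanishes on all of Z.
  have hy : ∀ i ∈ Z, p ((wordProd P v * σ)⁻¹ • P.root i) = 0 := by
    intro i hi
    rw [← heq, hp'] at hi
    exact hi.2
  have htr := hc.transversal.perm hperm.symm
  have hvsupp : ∀ k ∈ v, k ∈ b.support := fun k hk => htr.mem_support k (by simp [hk])
  have hvnodup : v.Nodup := (List.nodup_append.1 htr.nodup).2.1
  have hsymm : ∀ i ∈ b.support, rootPerm P σ⁻¹ i ∈ b.support := fun i hi => by
    rw [← rootPerm_mem_support_iff hσ, rootPerm_self_inv]; exact hi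
  -- the simple roots in the support of the image of a member of `Z`
  have hsupp : ∀ i ∈ Z, ∀ k ∈ b.support, ∀ φ : X →+ ℚ, φ (P.root k) = 1 →
      (∀ j ∈ b.support, j ≠ k → φ (P.root j) = 0) →
      0 < φ ((wordProd P v)⁻¹ • P.root i) → rootPerm P σ⁻¹ k ∈ Z := by
    intro i hi k hk φ hφk hφ0 hφ
    refine ⟨hsymm k hk, ?_⟩
    have hpos := isPos_wordProd_inv hvsupp hvnodup hv hi.1 hi
    -- p ∘ σ⁻¹ is nonnegative at simple roots and zero at the positive root v⁻¹α_i, so it vanishes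
    -- at every simple root that occurs in v⁻¹α_i.
    have hle := map_mul_le_of_isPos (f := p.comp (DistribSMul.toAddMonoidHom X σ⁻¹))
      (fun j hj => ?_) hφk hφ0 hpos
    · change _ * p (σ⁻¹ • P.root k) ≤ p (σ⁻¹ • P.root _) at hle
      rw [root_rootPerm, ← mul_smul, ← mul_inv_rev, hy i hi] at hle
      have h0 := hc.nonneg _ (hsymm k hk)
      rw [root_rootPerm] at h0 ⊢
      by_contra hne
      have := mul_pos hφ (lt_of_le_of_ne h0 (Ne.symm hne))
      linarith
    · change 0 ≤ p (σ⁻¹ • P.root j)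
      rw [← root_rootPerm]
      exact hc.nonneg _ (hsymm j hj)
  have hφ : ∀ k ∈ b.support, ∃ φ : X →+ ℚ, φ (P.root k) = 1 ∧
      ∀ j ∈ b.support, j ≠ k → φ (P.root j) = 0 := by
    intro k hk
    obtain ⟨φ, hφ⟩ := exists_functional_base b (fun j => if j = k then 1 else 0)
    exact ⟨φ, by rw [hφ k hk, if_pos rfl], fun j hj hjk => by rw [hφ j hj, if_neg hjk]⟩
  have hstep : ∀ i ∈ Z, i ∉ v → rootPerm P σ⁻¹ i ∈ Z := by
    intro i hi hiv
    obtain ⟨φ, hφ1, hφ0⟩ := hφ i hi.1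
    refine hsupp i hi i hi.1 φ hφ1 hφ0 ?_
    rw [map_wordProd_inv_smul, hφ1]
    · exact one_pos
    · exact fun j hj => hφ0 j (hvsupp j hj) (by rintro rfl; exact hiv hj)
  have hfirst : ∀ i ∈ Z, ∀ v₁ j v₂, v = v₁ ++ j :: v₂ → P.pairing j i ≠ 0 →
      (∀ k ∈ v₁, P.pairing k i = 0) → rootPerm P σ⁻¹ j ∈ Z := by
    intro i hi v₁ j v₂ hvj hji h1
    have hij : i ≠ j := by
      rintro rfl
      obtain ⟨k, hk, hki⟩ := hv v₁ i v₂ hvj hi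
      exact hki (h1 k hk)
    have hj : j ∈ b.support := hvsupp j (by simp [hvj])
    obtain ⟨φ, hφ1, hφ0⟩ := hφ j hj
    refine hsupp i hi j hj φ hφ1 hφ0 ?_
    rw [hvj]
    rw [hvj] at hvsupp hvnodup
    exact pos_map_wordProd_inv hvsupp hvnodup hi.1 hij hji h1 hφ1 hφ0
  -- the orbits of the letters of `v` do not meet `Z`
  have hdisj : ∀ n, ∀ v₁ x v₂, v = v₁ ++ x :: v₂ → v₁.length = n →
      ∀ i ∈ Z, ¬ SameOrbit P σ i x := by
    intro n
    induction n using Nat.strong_induction_on with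
    | _ n ih =>
      intro v₁ x v₂ hvx hn i hi hix
      have hx : x ∈ v := by simp [hvx]
      -- If x ∉ Z, the members of Z in the orbit of x are not letters of v, by transversality. So
      -- σ⁻¹ keeps them in Z, and by finiteness Z contains the whole orbit, including x.
      have hxZ : x ∈ Z := by
        by_contra hxZ
        have h1 : ∀ k ∈ {k | k ∈ Z ∧ SameOrbit P σ k x},
            rootPerm P σ⁻¹ k ∈ {k | k ∈ Z ∧ SameOrbit P σ k x} := by
          rintro k ⟨hk, hkx⟩
          refine ⟨hstep k hk fun hkv => hxZ ?_, ?_⟩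
          · rwa [← htr.eq_of_sameOrbit (by simp [hkv]) (by simp [hx]) hkx]
          · rw [← sameOrbit_rootPerm_iff, rootPerm_self_inv]
            exact hkx
        have h2 := rootPerm_inv_mapsTo h1
        rw [inv_inv] at h2
        refine hxZ (mem_of_sameOrbit (S := {k | k ∈ Z ∧ SameOrbit P σ k x}) (fun k => ⟨fun hk => ?_,
          h2 k⟩) hix ⟨hi, hix⟩).1
        simpa using h1 _ hk
      -- Now x is blocked. The first letter j not orthogonal to x comes earlier and has σ⁻¹j ∈ Z,
      -- against the induction hypothesis.
      obtain ⟨j, hj, hjx⟩ := hv v₁ x v₂ hvx hxZ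
      rcases exists_first_or v₁ (fun j => P.pairing j x ≠ 0) with h | ⟨v₃, j, v₄, hv1, hjx, h⟩
      · exact h j hj hjx
      · have hvj : v = v₃ ++ j :: (v₄ ++ x :: v₂) := by rw [hvx, hv1]; simp
        have := hfirst x hxZ v₃ j _ hvj hjx (fun k hk => not_not.1 (h k hk))
        refine ih v₃.length ?_ v₃ j _ hvj rfl _ this ?_
        · rw [← hn, hv1]; simp
        · rw [← sameOrbit_rootPerm_iff, rootPerm_self_inv]
          exact SameOrbit.refl _ _
  have hdisj : ∀ x ∈ v, ∀ i ∈ Z, ¬ SameOrbit P σ i x := by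
    intro x hx
    obtain ⟨v₁, v₂, hvx⟩ := List.append_of_mem hx
    exact hdisj _ v₁ x v₂ hvx rfl
  have hZσ' : ∀ i ∈ Z, rootPerm P σ⁻¹ i ∈ Z := fun i hi =>
    hstep i hi fun hiv => hdisj i hiv i hi (SameOrbit.refl _ _)
  have hZσ : ∀ i, rootPerm P σ i ∈ Z ↔ i ∈ Z := by
    have h2 := rootPerm_inv_mapsTo hZσ'
    rw [inv_inv] at h2
    exact fun i => ⟨fun hi => by simpa using hZσ' _ hi, h2 i⟩
  have hvZ : ∀ i ∈ Z, ∀ j ∈ v, P.pairing j i = 0 := by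
    intro i hi
    rcases exists_first_or v (fun j => P.pairing j i ≠ 0) with h | ⟨v₁, j, v₂, hvj, hji, h⟩
    · exact fun j hj => not_not.1 (h j hj)
    · have := hfirst i hi v₁ j v₂ hvj hji (fun k hk => not_not.1 (h k hk))
      refine absurd ?_ (hdisj j (by simp [hvj]) _ this)
      rw [← sameOrbit_rootPerm_iff, rootPerm_self_inv]
      exact SameOrbit.refl _ _
  refine ⟨hZσ, fun k hk hkZ i hi => ?_⟩
  obtain ⟨x, hx, hkx⟩ := htr.exists_mem k hk
  rcases List.mem_append.1 hx with hx | hx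
  · exact absurd (mem_of_sameOrbit hZσ hkx.symm (hu x hx)) hkZ
  · obtain ⟨m, rfl⟩ := hkx
    rw [← pairing_rootPerm P (σ ^ m)]
    exact hvZ _ (mem_of_sameOrbit hZσ (sameOrbit_rootPerm_zpow σ m i) hi) _ hx

omit [P.IsReduced] in
/-- A configuration can be improved so that the zero set is stable under `σ` and orthogonal to the
other simple roots. -/
lemma IsConfiguration.exists_minimal {g τ : P.Aut} {l : List ι} {p : X →+ ℚ}
    (hc : IsConfiguration b σ g τ 1 l p) (hcomm : Commute g τ) :
    ∃ u l' p', (∀ i ∈ u, i ∈ b.support) ∧ IsConfiguration b σ g τ (wordProd P u) l' p' ∧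
      zeroSet b p' ⊆ zeroSet b p ∧ (∀ i, rootPerm P σ i ∈ zeroSet b p' ↔ i ∈ zeroSet b p') ∧
      ∀ i ∈ b.support, i ∉ zeroSet b p' → ∀ j ∈ zeroSet b p', P.pairing i j = 0 := by
  classical
  let Q : ℕ → Prop := fun n => ∃ u l' p', (∀ i ∈ u, i ∈ b.support) ∧
    IsConfiguration b σ g τ (wordProd P u) l' p' ∧ zeroSet b p' ⊆ zeroSet b p ∧
    (zeroSet b p').ncard = n
  have hQ : ∃ n, Q n := ⟨_, [], l, p, by simp, hc, subset_rfl, rfl⟩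
  obtain ⟨u, l', p', hu, hc', hsub, hn⟩ := Nat.find_spec hQ
  refine ⟨u, l', p', hu, hc', hsub, hc'.zeroSet_of_minimal hσ hcomm fun u' l'' p'' hu' hc'' hs => ?_⟩
  have hmin := Nat.find_min' hQ (m := (zeroSet b p'').ncard)
    ⟨u ++ u', l'', p'', fun i hi => (List.mem_append.1 hi).elim (hu i) (hu' i),
      by rwa [wordProd_append], hs.trans hsub, rfl⟩
  exact Set.eq_of_subset_of_ncard_le hs (by rw [hn]; exact hmin) (Set.toFinite _)

end Configuration

/-! ### Automorphisms that fix the simple roots at a point -/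

section Rigidity

variable {P : RootDatum ι X Y} {b : P.Base} {σ : P.Aut}

lemma zpow_mem_iff {Γ : Set ι} (hσΓ : ∀ i, rootPerm P σ i ∈ Γ ↔ i ∈ Γ) (n : ℤ) (i : ι) :
    rootPerm P (σ ^ n) i ∈ Γ ↔ i ∈ Γ :=
  ⟨mem_of_sameOrbit hσΓ (sameOrbit_rootPerm_zpow σ n i).symm,
    mem_of_sameOrbit hσΓ (sameOrbit_rootPerm_zpow σ n i)⟩

/-- An automorphism that fixes the simple roots in a union of components fixes all its roots. -/
lemma rootPerm_eq_self_of_simple [Finite ι] [P.IsReduced] {Γ : Set ι}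
    (hΓ : ∀ i j, SameComponent P i j → i ∈ Γ → j ∈ Γ) {τ : P.Aut}
    (h : ∀ i ∈ b.support, i ∈ Γ → rootPerm P τ i = i) {i : ι} (hi : i ∈ Γ) :
    rootPerm P τ i = i := by
  classical
  have hcl := root_mem_closure_or (b := b) (N := {k | k ∈ b.support ∧ k ∈ Γ})
    (Z := {k | k ∈ b.support ∧ k ∉ Γ})
    (fun k hk => (em (k ∈ Γ)).imp (fun h => ⟨hk, h⟩) (fun h => ⟨hk, h⟩))
    (fun k hk j hj => by
      by_contra hne
      exact hj.2 (hΓ k j (.rel _ _ hne) hk.2)) i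
  rcases hcl with hcl | hcl
  · apply P.root.injective
    rw [root_rootPerm]
    have hle : AddSubgroup.closure (P.root '' {k | k ∈ b.support ∧ k ∈ Γ}) ≤
        (DistribSMul.toAddMonoidHom X τ).eqLocus (AddMonoidHom.id X) := by
      rw [AddSubgroup.closure_le]
      rintro _ ⟨k, hk, rfl⟩
      change τ • P.root k = P.root k
      rw [← root_rootPerm, h k hk.1 hk.2]
    exact hle hcl
  · have : P.pairing i i = 0 := pairing_eq_zero_of_mem_closure (fun k hk => by
      by_contra hne
      exact hk.2 (hΓ i k (.symm _ _ (.rel _ _ hne)) hi)) hcl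
    rw [RootPairing.pairing_same] at this
    norm_num at this

/-- An element of `W σ ^ n` that commutes with a twisted Coxeter element and leaves invariant
a functional that is positive at the simple roots of a union of components acts trivially on
this union. -/
lemma IsTransversal.rootPerm_eq_self_of_commute [Finite ι] [P.IsReduced]
    (hσ : rootPerm P σ '' b.support = b.support) {l : List ι} (hl : IsTransversal b σ l)
    {Γ : Set ι} (hΓ : ∀ i j, SameComponent P i j → i ∈ Γ → j ∈ Γ)
    (hσΓ : ∀ i, rootPerm P σ i ∈ Γ ↔ i ∈ Γ) {L : List ι} (hL : ∀ j ∈ L, j ∈ b.support) {n : ℤ}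
    (hcomm : Commute (wordProd P l * σ) (wordProd P L * σ ^ n)) {p : X →+ ℚ}
    (hp : ∀ i ∈ b.support, 0 ≤ p (P.root i))
    (hinv : ∀ i, p ((wordProd P L * σ ^ n) • P.root i) = p (P.root i))
    (hpos : ∀ i ∈ b.support, i ∈ Γ → 0 < p (P.root i)) {i : ι} (hi : i ∈ Γ) :
    rootPerm P (wordProd P L * σ ^ n) i = i := by
  classical
  have hword : ∀ (L : List ι) {i}, i ∈ Γ → rootPerm P (wordProd P L) i ∈ Γ := fun L i hi =>
    hΓ _ _ (sameComponent_wordProd L i) hi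
  have hσn := rootPerm_zpow_image hσ n
  -- p is positive at the positive roots of Γ and invariant under wσ^n, where σ^n permutes these
  -- roots; so w keeps them positive.
  have hL1 : ∀ i ∈ Γ, rootPerm P (wordProd P L) i = i := by
    refine rootPerm_wordProd_eq_self hΓ hL fun i hi hip => ?_
    have hi' : rootPerm P (σ ^ n)⁻¹ i ∈ Γ := by
      rw [← zpow_mem_iff hσΓ n, rootPerm_self_inv]
      exact hi
    have hip' : b.IsPos (rootPerm P (σ ^ n)⁻¹ i) := by
      rw [← isPos_rootPerm_iff hσn, rootPerm_self_inv]
      exact hip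
    refine isPos_of_map_pos hp ?_
    have h1 := hinv (rootPerm P (σ ^ n)⁻¹ i)
    rw [← root_rootPerm, rootPerm_mul, rootPerm_self_inv] at h1
    rw [h1]
    exact map_pos_of_isPos hp (fun k hk hne =>
      hpos k hk (hΓ _ _ (.symm _ _ (.rel _ _ hne)) hi')) hip'
  have hτ : ∀ i ∈ Γ, rootPerm P (wordProd P L * σ ^ n) i = rootPerm P (σ ^ n) i := fun i hi => by
    rw [rootPerm_mul, hL1 _ ((zpow_mem_iff hσΓ n i).2 hi)]
  -- On Γ the element wσ^n acts as σ^n, so commutation says that the words l and σ^n(l) act alike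
  -- there.
  have hmap : ∀ j ∈ Γ, rootPerm P (wordProd P (l.map (rootPerm P (σ ^ n)))) j =
      rootPerm P (wordProd P l) j := by
    intro j hj
    set k := rootPerm P (σ ^ (n + 1))⁻¹ j with hk
    have hjk : rootPerm P (σ ^ (n + 1)) k = j := rootPerm_self_inv ..
    have hkΓ : k ∈ Γ := by
      rw [← zpow_mem_iff hσΓ (n + 1), hjk]
      exact hj
    have h1 := congrArg (fun g => rootPerm P g k) hcomm.eq
    beta_reduce at h1
    rw [rootPerm_mul, hτ k hkΓ, ← rootPerm_mul, mul_assoc, ← zpow_one_add, add_comm, rootPerm_mul,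
      hjk, rootPerm_mul, hτ, ← rootPerm_mul] at h1
    · rw [h1, ← conj_wordProd]
      nth_rw 1 [← hjk]
      rw [← rootPerm_mul, zpow_add_one]
      congr 2
      group
    · rw [rootPerm_mul]
      exact hword l ((hσΓ k).2 hkΓ)
  have hletter : ∀ x ∈ l, x ∈ Γ → rootPerm P (σ ^ n) x = x := by
    intro x hx hxΓ
    by_contra hne
    obtain ⟨φ, hφ⟩ := exists_functional_base b (fun k => if k = x then 1 else 0)
    -- A moved letter x is not in σ^n(l), since l has only one letter in its orbit; the coordinate
    -- at x then separates the two words.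
    have hxm : x ∉ l.map (rootPerm P (σ ^ n)) := by
      intro h
      obtain ⟨y, hy, hyx⟩ := List.mem_map.1 h
      obtain rfl := hl.eq_of_sameOrbit hy hx ⟨n, hyx⟩
      exact hne hyx
    have h0 : ∀ l : List ι, (∀ i ∈ l, i ∈ b.support) → x ∉ l → ∀ i ∈ l, φ (P.root i) = 0 :=
      fun l hl hxl i hi => by rw [hφ i (hl i hi), if_neg (by rintro rfl; exact hxl hi)]
    obtain ⟨l₁, l₂, rfl⟩ := List.append_of_mem hx
    have hnodup := hl.nodup
    rw [List.nodup_append] at hnodup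
    refine exists_wordProd_ne P (f := φ) (k := x) (l₁ := l₁) (l₂ := l₂)
      (l' := (l₁ ++ x :: l₂).map (rootPerm P (σ ^ n))) ?_
      (h0 l₁ (fun i hi => hl.mem_support i (by simp [hi])) fun h => hnodup.2.2 x h x (by simp) rfl)
      (h0 l₂ (fun i hi => hl.mem_support i (by simp [hi])) (List.nodup_cons.1 hnodup.2.1).1)
      (h0 _ (fun i hi => ?_) hxm) ?_
    · rw [hφ x (hl.mem_support x (by simp)), if_pos rfl]
      exact one_ne_zero
    · obtain ⟨k, hk, rfl⟩ := List.mem_map.1 hi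
      exact (rootPerm_mem_support_iff hσn).2 (hl.mem_support k hk)
    · refine (hmap _ ?_).symm
      rw [← wordProd_reverse]
      exact hword _ hxΓ
  rw [hτ i hi]
  refine rootPerm_eq_self_of_simple (b := b) hΓ (fun k hk hkΓ => ?_) hi
  obtain ⟨x, hx, m, rfl⟩ := hl.exists_mem k hk
  apply rootPerm_injective P (σ ^ m)
  rw [← rootPerm_mul, ← zpow_add, add_comm, zpow_add, rootPerm_mul,
    hletter _ hx ((zpow_mem_iff hσΓ m k).2 hkΓ)]

/-- Moving every σ to the right shows that powers of σ_{I,c} lie in W σ^n. -/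
lemma exists_wordProd_mul_zpow (hσ : rootPerm P σ '' b.support = b.support) {L : List ι}
    (hL : ∀ j ∈ L, j ∈ b.support) (n : ℤ) :
    ∃ L', (∀ j ∈ L', j ∈ b.support) ∧ (wordProd P L * σ) ^ n = wordProd P L' * σ ^ n := by
  have hmap : ∀ (m : ℤ) (L : List ι), (∀ j ∈ L, j ∈ b.support) →
      ∀ j ∈ L.map (rootPerm P (σ ^ m)), j ∈ b.support := by
    intro m L hL j hj
    obtain ⟨k, hk, rfl⟩ := List.mem_map.1 hj
    exact (rootPerm_mem_support_iff (rootPerm_zpow_image hσ m)).2 (hL k hk)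
  induction n using Int.induction_on with
  | zero => exact ⟨[], by simp, by simp⟩
  | succ n ih =>
    obtain ⟨L', hL', h⟩ := ih
    refine ⟨L' ++ L.map (rootPerm P (σ ^ (n : ℤ))), fun j hj =>
      (List.mem_append.1 hj).elim (hL' j) (hmap _ L hL j), ?_⟩
    rw [zpow_add_one, h, wordProd_append, ← conj_wordProd, zpow_add_one]
    group
  | pred n ih =>
    obtain ⟨L', hL', h⟩ := ih
    refine ⟨L' ++ L.reverse.map (rootPerm P (σ ^ (-n - 1 : ℤ))), fun j hj =>
      (List.mem_append.1 hj).elim (hL' j) (hmap _ _ (fun j hj => hL j (List.mem_reverse.1 hj)) j),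
      ?_⟩
    rw [zpow_sub_one, h, wordProd_append, ← conj_wordProd, wordProd_reverse, mul_inv_rev]
    group

end Rigidity

/-! ### Components that meet the orbits of the remaining letters -/

section Components

variable {P : RootDatum ι X Y} {b : P.Base} {σ : P.Aut} {r : ℕ} {α : Fin r → ι}
  {I : Finset (Fin r)}

/-- The union of the `σ`-translates of the irreducible components that contain some `α k`,
`k ∉ I`. -/
def componentsOff (P : RootDatum ι X Y) (σ : P.Aut) (α : Fin r → ι) (I : Finset (Fin r)) : Set ι :=
  {i | ∃ k, k ∉ I ∧ ∃ m : ℤ, SameComponent P i (rootPerm P (σ ^ m) (α k))}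

lemma mem_componentsOff_of_sameComponent {i j : ι} (h : SameComponent P i j)
    (hi : i ∈ componentsOff P σ α I) : j ∈ componentsOff P σ α I := by
  obtain ⟨k, hk, m, hm⟩ := hi
  exact ⟨k, hk, m, .trans _ _ _ (.symm _ _ h) hm⟩

lemma zpow_mem_componentsOff (n : ℤ) {i : ι} (hi : i ∈ componentsOff P σ α I) :
    rootPerm P (σ ^ n) i ∈ componentsOff P σ α I := by
  obtain ⟨k, hk, m, hm⟩ := hi
  refine ⟨k, hk, n + m, ?_⟩
  rw [zpow_add, rootPerm_mul]
  exact hm.rootPerm _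

lemma rootPerm_mem_componentsOff_iff {i : ι} :
    rootPerm P σ i ∈ componentsOff P σ α I ↔ i ∈ componentsOff P σ α I := by
  refine ⟨fun h => ?_, fun h => by simpa using zpow_mem_componentsOff 1 h⟩
  have := zpow_mem_componentsOff (-1) h
  rwa [zpow_neg_one, rootPerm_inv_self] at this

variable (hσ : rootPerm P σ '' b.support = b.support) (hα : ∀ k, α k ∈ b.support)

include hα in
lemma mem_support_of_mem_subProd {S : Finset (Fin r)} {j : ι}
    (hj : j ∈ (S.sort (· ≤ ·)).map α) : j ∈ b.support := by
  obtain ⟨k, -, rfl⟩ := List.mem_map.1 hj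
  exact hα k

variable (hrep : ∀ i ∈ b.support, ∃! k, SameOrbit P σ i (α k))

include hα hrep in
lemma isTransversal_ofFn : IsTransversal b σ (List.ofFn α) where
  mem_support i hi := by
    obtain ⟨k, rfl⟩ := (List.mem_ofFn' _ _).1 hi
    exact hα k
  pairwise := List.pairwise_ofFn.2 fun _ _ hjk h => hjk.ne (eq_of_sameOrbit hα hrep h)
  exists_mem i hi := by
    obtain ⟨k, hk, -⟩ := hrep i hi
    exact ⟨α k, (List.mem_ofFn' _ _).2 ⟨k, rfl⟩, hk⟩

/-- The power fixes the letters of c_I, so it commutes with both factors of g = c_I σ_{I,c}. -/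
lemma commute_sigmaSub_zpow {n : ℤ}
    (hfix : ∀ j, j ∉ I → rootPerm P (sigmaSub P σ α I ^ n) (betaSub P α I j) = betaSub P α I j) :
    Commute (coxeterProd P α * σ) (sigmaSub P σ α I ^ n) := by
  rw [← coxeterSub_mul_sigmaSub (I := I)]
  refine Commute.mul_left ?_ (Commute.self_zpow _ n)
  have h := conj_wordProd P (sigmaSub P σ α I ^ n) ((Iᶜ.sort (· ≤ ·)).map (betaSub P α I))
  have hmap : ((Iᶜ.sort (· ≤ ·)).map (betaSub P α I)).map (rootPerm P (sigmaSub P σ α I ^ n)) =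
      (Iᶜ.sort (· ≤ ·)).map (betaSub P α I) := by
    rw [List.map_map]
    exact List.map_congr_left fun j hj => hfix j (by simpa using hj)
  rw [hmap, mul_inv_eq_iff_eq_mul] at h
  exact h.symm

variable [Finite ι] [P.IsReduced]

include hσ hα hrep in
/-- A power of `σ_{I,c}` that fixes the roots `β_j` acts trivially on the components that contain
some translate of an `α k`, `k ∉ I`. -/
lemma sigmaSub_zpow_eq_self {n : ℤ}
    (hfix : ∀ j, j ∉ I → rootPerm P (sigmaSub P σ α I ^ n) (betaSub P α I j) = betaSub P α I j)
    {i : ι} (hi : i ∈ componentsOff P σ α I) : rootPerm P (sigmaSub P σ α I ^ n) i = i := by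
  classical
  set τ := sigmaSub P σ α I ^ n with hτ
  have hcomm : Commute (coxeterProd P α * σ) τ := commute_sigmaSub_zpow hfix
  obtain ⟨Lτ, hLτ, hLτ'⟩ := exists_wordProd_mul_zpow hσ
    (fun j hj => mem_support_of_mem_subProd (S := I) hα hj) n
  change τ = wordProd P Lτ * σ ^ n at hLτ'
  obtain ⟨p, hp, hpσ⟩ := exists_invariant_functional b hσ
    (fun i => if ∃ k, k ∉ I ∧ SameOrbit P σ i (α k) then 1 else 0)
    (fun i => by simp only [sameOrbit_rootPerm_iff])
  have hpI : ∀ k ∈ I, p (P.root (α k)) = 0 := fun k hk => by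
    rw [hp _ (hα k), if_neg]
    rintro ⟨j, hj, h⟩
    exact hj (eq_of_sameOrbit hα hrep h ▸ hk)
  have hpτ : ∀ i, p (τ • P.root i) = p (P.root i) := fun i => by
    rw [← root_rootPerm]
    refine (SameOrbit.eq_of_invariant (F := fun i => p (P.root i)) (fun i => ?_)
      (sameOrbit_rootPerm_zpow (sigmaSub P σ α I) n i)).symm
    rw [root_rootPerm, sigmaSub, mul_smul, ← root_rootPerm, map_subProd_smul hpI, root_rootPerm,
      hpσ]
  have hc : IsConfiguration b σ (coxeterProd P α * σ) τ 1 (List.ofFn α) p := by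
    refine ⟨isTransversal_ofFn hα hrep, by simp [coxeterProd], by simpa using hpτ, fun i hi => ?_⟩
    rw [hp i hi]
    split_ifs <;> norm_num
  obtain ⟨u, l, p', hu, hc', hsub, hZσ, horth⟩ := hc.exists_minimal hσ hcomm
  have hpos : ∀ i ∈ b.support, i ∈ componentsOff P σ α I → 0 < p' (P.root i) := by
    rintro i hi ⟨k, hk, m, hm⟩
    refine lt_of_le_of_ne (hc'.nonneg i hi) fun h0 => ?_
    have hkZ : α k ∉ zeroSet b p' := fun h => by
      have := (hsub h).2
      rw [hp _ (hα k), if_pos ⟨k, hk, SameOrbit.refl _ _⟩] at this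
      exact one_ne_zero this
    -- σ^m α_k is not in the zero set of p', which is orthogonal to the other simple roots. So the
    -- component of σ^m α_k lies in the span of those others, which contains no simple root where p'
    -- vanishes.
    have hcl := (hm.root_mem_closure_iff (b := b)
      (N := {i | i ∈ b.support ∧ i ∉ zeroSet b p'}) (Z := zeroSet b p')
      (fun j hj => (em (j ∈ zeroSet b p')).elim .inr fun h => .inl ⟨hj, h⟩)
      (fun j hj => horth j hj.1 hj.2)).2 (AddSubgroup.subset_closure (Set.mem_image_of_mem _
        ⟨(rootPerm_mem_support_iff (rootPerm_zpow_image hσ m)).2 (hα k),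
          mt (zpow_mem_iff hZσ m _).1 hkZ⟩))
    obtain ⟨φ, hφ⟩ := exists_functional_base b (fun j => if j = i then 1 else 0)
    have := map_eq_zero_of_mem_closure (f := φ) (by
      rintro _ ⟨j, hj, rfl⟩
      rw [hφ j hj.1, if_neg]
      rintro rfl
      exact hj.2 ⟨hi, h0.symm⟩) hcl
    rw [hφ i hi, if_pos rfl] at this
    exact one_ne_zero this
  have hconj : (wordProd P u)⁻¹ * τ * wordProd P u =
      wordProd P (u.reverse ++ Lτ ++ u.map (rootPerm P (σ ^ n))) * σ ^ n := by
    rw [wordProd_append, wordProd_append, wordProd_reverse, ← conj_wordProd, hLτ']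
    group
  have hL : ∀ j ∈ u.reverse ++ Lτ ++ u.map (rootPerm P (σ ^ n)), j ∈ b.support := by
    intro j hj
    rw [List.mem_append, List.mem_append, List.mem_reverse, List.mem_map] at hj
    rcases hj with (hj | hj) | ⟨k, hk, rfl⟩
    · exact hu j hj
    · exact hLτ j hj
    · exact (rootPerm_mem_support_iff (rootPerm_zpow_image hσ n)).2 (hu k hk)
  have hcomm' : Commute (wordProd P l * σ) ((wordProd P u)⁻¹ * τ * wordProd P u) := by
    rw [← hc'.conj, Commute, SemiconjBy]
    calc _ = (wordProd P u)⁻¹ * (coxeterProd P α * σ * τ) * wordProd P u := by group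
      _ = _ := by rw [hcomm.eq]; group
  have hinv := hc'.invariant
  rw [hconj] at hcomm' hinv
  have key := fun {i} hi => hc'.transversal.rootPerm_eq_self_of_commute hσ
    (fun _ _ => mem_componentsOff_of_sameComponent) (fun _ => rootPerm_mem_componentsOff_iff) hL
    hcomm' hc'.nonneg hinv hpos (i := i) hi
  rw [← hconj] at key
  have hi' : rootPerm P (wordProd P u)⁻¹ i ∈ componentsOff P σ α I := by
    rw [← wordProd_reverse]
    exact mem_componentsOff_of_sameComponent (sameComponent_wordProd _ _) hi
  have h := key hi'
  rw [rootPerm_mul, rootPerm_mul, rootPerm_self_inv] at h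
  exact rootPerm_injective P _ h

variable {e : ℚ ⊗[ℤ] Y} {μ : Y} (hI : ∀ j, j ∈ I ↔ betaSub P α I j ∉ rootsAt P e)
  (he : IsFixedPoint P (coxeterProd P α * σ) μ e)

include hσ hα hrep hI he

/-- A root of Φ_e is not orthogonal to some β ∈ Δ_e, and β is a σ_{I,c}^n-translate of some β_m. As
σ_{I,c}^n ∈ W σ^n and W preserves components, β lies in the component of σ^n α_m. -/
lemma componentsAt_subset_componentsOff : componentsAt P σ e ⊆ componentsOff P σ α I := by
  rintro i ⟨j, hj, k, hij⟩
  refine mem_componentsOff_of_sameComponent (.symm _ _ hij) (zpow_mem_componentsOff k ?_)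
  obtain ⟨β, hβ, hβj⟩ := exists_simpleRootsAt_pairing_ne_zero b hj
  refine mem_componentsOff_of_sameComponent (.rel _ _ hβj) ?_
  obtain ⟨m, hm, hβm⟩ := exists_sameOrbit_betaSub hσ hα hrep hI he hβ
  obtain ⟨n, rfl⟩ := hβm.symm
  obtain ⟨L, -, hL⟩ := exists_wordProd_mul_zpow hσ
    (fun j hj => mem_support_of_mem_subProd (S := I) hα hj) n
  change sigmaSub P σ α I ^ n = _ at hL
  rw [hL, rootPerm_mul]
  refine mem_componentsOff_of_sameComponent (sameComponent_wordProd _ _)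
    (zpow_mem_componentsOff n ?_)
  exact mem_componentsOff_of_sameComponent (sameComponent_wordProd _ _)
    ⟨m, hm, 0, by simpa using .refl _⟩

/-- A power of `σ_{I,c}` acts trivially on the components that meet the roots at `e` if and only
if it fixes the simple roots at `e`. -/
lemma sigmaSub_zpow_eq_self_iff (n : ℤ) :
    (∀ i ∈ componentsAt P σ e, rootPerm P (sigmaSub P σ α I ^ n) i = i) ↔
      ∀ i ∈ simpleRootsAt b e, rootPerm P (sigmaSub P σ α I ^ n) i = i := by
  refine ⟨fun h i hi => h i ⟨i, hi.1.1, 0, by simpa using .refl _⟩, fun h i hi => ?_⟩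
  exact sigmaSub_zpow_eq_self hσ hα hrep
    (fun j hj => h _ (betaSub_mem_simpleRootsAt hα hI hj))
    (componentsAt_subset_componentsOff hσ hα hrep hI he hi)

omit hσ hα hrep he [Finite ι] [P.IsReduced] in
lemma coxeterSub_mem_weylAt : coxeterSub P α I ∈ weylAt P e := by
  refine Subgroup.list_prod_mem _ fun g hg => ?_
  obtain ⟨k, hk, rfl⟩ := List.mem_map.1 hg
  exact Subgroup.subset_closure ⟨k, betaSub_mem_rootsAt hI hk, rfl⟩

end Components

end TwistedCoxeter

end

/-! ### The theorem for the greedy subset -/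

theorem mainTheorem3 {ι X Y : Type*} [Finite ι]
    [AddCommGroup X] [AddCommGroup Y] [Module.Finite ℤ X] [Module.Finite ℤ Y]
    (P : RootDatum ι X Y) [P.IsReduced] (b : P.Base)
    -- an automorphism of the based root datum
    (σ : P.Aut) (hσ : TwistedCoxeter.rootPerm P σ '' b.support = b.support)
    -- representatives `α 1, …, α r` of the `σ`-orbits of simple roots
    {r : ℕ} (α : Fin r → ι) (hα : ∀ k, α k ∈ b.support)
    (hrep : ∀ i ∈ b.support, ∃! k, TwistedCoxeter.SameOrbit P σ i (α k))
    -- the fixed point `e` attached to `μ` and `c = s_{α 1} ⋯ s_{α r}`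
    (μ : Y) (e : ℚ ⊗[ℤ] Y)
    (he : TwistedCoxeter.IsFixedPoint P (TwistedCoxeter.coxeterProd P α * σ) μ e) :
    ∃ I : Finset (Fin r),
      -- (1)
      TwistedCoxeter.rootPerm P (TwistedCoxeter.sigmaSub P σ α I) ''
          TwistedCoxeter.simpleRootsAt b e = TwistedCoxeter.simpleRootsAt b e ∧
      -- (2)
      (TwistedCoxeter.deltaSub P α I ⊆ TwistedCoxeter.simpleRootsAt b e ∧
        ∀ i ∈ TwistedCoxeter.simpleRootsAt b e, ∃! j, j ∈ TwistedCoxeter.deltaSub P α I ∧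
          TwistedCoxeter.SameOrbit P (TwistedCoxeter.sigmaSub P σ α I) i j) ∧
      -- (3)
      (∀ n : ℤ,
        (∀ i ∈ TwistedCoxeter.componentsAt P σ e,
          TwistedCoxeter.rootPerm P (TwistedCoxeter.sigmaSub P σ α I ^ n) i = i) ↔
        (∀ i ∈ TwistedCoxeter.simpleRootsAt b e,
          TwistedCoxeter.rootPerm P (TwistedCoxeter.sigmaSub P σ α I ^ n) i = i)) ∧
      -- `c_I` is a `σ_{I,c}`-Coxeter element of `W_e`
      (TwistedCoxeter.coxeterSub P α I ∈ TwistedCoxeter.weylAt P e ∧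
        TwistedCoxeter.IsCoxeterElement P (TwistedCoxeter.simpleRootsAt b e)
          (TwistedCoxeter.sigmaSub P σ α I) (TwistedCoxeter.coxeterSub P α I)) := by
  obtain ⟨I, hI⟩ := TwistedCoxeter.exists_greedy fun S j =>
    TwistedCoxeter.rootPerm P (TwistedCoxeter.subProd P α S) (α j) ∉ TwistedCoxeter.rootsAt P e
  replace hI : ∀ j, j ∈ I ↔ TwistedCoxeter.betaSub P α I j ∉ TwistedCoxeter.rootsAt P e := hI
  refine ⟨I, TwistedCoxeter.sigmaSub_image_simpleRootsAt hα hI hσ he, ⟨?_, fun i hi =>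
    TwistedCoxeter.existsUnique_mem_deltaSub hσ hα hrep hI he hi⟩,
    TwistedCoxeter.sigmaSub_zpow_eq_self_iff hσ hα hrep hI he,
    TwistedCoxeter.coxeterSub_mem_weylAt hI,
    TwistedCoxeter.isCoxeterElement_coxeterSub hσ hα hrep hI he⟩
  rintro _ ⟨j, hj, rfl⟩
  exact TwistedCoxeter.betaSub_mem_simpleRootsAt hα hI hj
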